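/- Write $\mathbb{N}=\{1,2,\dots\}$. **Locally decodable codes.** Let $m,n\in\mathbb{N}$ and $\phi,\theta\in(0,1/2)$. A function $C:\{-1,1\}^m\to\{-1,1\}^n$ is a 3-query locally decodable code of quality $(\phi,\theta)$ if for every $t\in\{1,\dots,m\}$ there is a probability distribution $\mathcal{A}_t$ on 4-tuples $(i,j,k,g)$, with $i,j,k\in\{1,\dots,n\}$ and $g:\{-1,1\}^3\to\{-1,1\}$, such that for every $\varepsilon\in\{-1,1\}^m$ and every $\delta\in\{-1,1\}^n$ that differs from $C(\varepsilon)$ in at most $\phi n$ coordinates, $g(\delta_i,\delta_j,\delta_k)=\varepsilon_t$ holds with $\mathcal{A}_t$-probability at least $\frac12+\theta$. **Cotype constants.** For $q\in[2,\infty)$ and a norm $\|\cdot\|$ on a real vector space $X$, let $C^{(q)}_{\|\cdot\|}$ be the infimum of all $C\in(0,\infty)$ such that for every $k\in\mathbb{N}$ and all $x_1,\dots,x_k\in X$, $$\Big(\sum_{i=1}^k\|x_i\|^q\Big)^{1/q}\le C\Big(\mathbb{E}\Big\|\sum_{i=1}^k\varepsilon_i x_i\Big\|^2\Big)^{1/2},$$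 where $\varepsilon$ is uniformly distributed on $\{-1,1\}^k$. **Tensor symmetry.** Let $e_1,\dots,e_N$ be the standard basis of $\mathbb{R}^N$. For $K\in[1,\infty)$, a norm $\|\cdot\|$ on $\mathbb{R}^N\otimes\mathbb{R}^N\otimes\mathbb{R}^N$ is $K$-tensor-symmetric if for all permutations $\pi,\sigma,\tau$ of $\{1,\dots,N\}$, all $\varepsilon,\delta,\eta\in\{-1,1\}^N$ and all real scalars $(a_{i,j,k})_{i,j,k=1}^N$, $$\Big\|\sum_{i,j,k=1}^N\varepsilon_i\delta_j\eta_k\,a_{\pi(i),\sigma(j),\tau(k)}\,e_i\otimes e_j\otimes e_k\Big\|\le K\Big\|\sum_{i,j,k=1}^N a_{i,j,k}\,e_i\otimes e_j\otimes e_k\Big\|.$$ **Theorem.** There is a universal constant $c>0$ such that the following holds. Let $m,n\in\mathbb{N}$ and $\phi,\theta\in(0,1/2)$, and suppose that there exists a 3-query locally decodable code $C:\{-1,1\}^m\to\{-1,1\}^n$ of quality $(\phi,\theta)$. Then for every $K\in[1,\infty)$, every $K$-tensor-symmetric norm $\|\cdot\|$ on $\mathbb{R}^{3n}\otimes\mathbb{R}^{3n}\otimes\mathbb{R}^{3n}$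 and every $q\in[2,\infty)$, $$K^2\,C^{(q)}_{\|\cdot\|}\cdot\frac{\Big\|\sum_{i=1}^{3n}\sum_{j=1}^{3n}\sum_{k=1}^{3n}e_i\otimes e_j\otimes e_k\Big\|}{\Big\|\sum_{i=1}^{3n}e_i\otimes e_i\otimes e_i\Big\|}\ \ge\ c\,\frac{\phi\,\theta^2\,m^{1/q}}{\log(n+1)}.$$ -/

import Mathlib

open scoped TensorProduct

/-- `C : {-1,1}^m → {-1,1}^n` is a 3-query locally decodable code of quality `(φ, θ)`.
The set `{-1,1}` is `ℤˣ`. For each message coordinate `t` the decoder is a probability distribution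
`A` on tuples `(i, j, k, g)`, chosen before the message `ε` and the corrupted word `δ`. -/
def IsThreeQueryLDC {m n : ℕ} (φ θ : ℝ) (C : (Fin m → ℤˣ) → (Fin n → ℤˣ)) : Prop :=
  ∀ t : Fin m, ∃ A : PMF (Fin n × Fin n × Fin n × (ℤˣ → ℤˣ → ℤˣ → ℤˣ)),
    ∀ (ε : Fin m → ℤˣ) (δ : Fin n → ℤˣ), (hammingDist δ (C ε) : ℝ) ≤ φ * n →
      1 / 2 + θ ≤
        (A.toOuterMeasure {s | s.2.2.2 (δ s.1) (δ s.2.1) (δ s.2.2.1) = ε t}).toReal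

/-- The cotype `q` inequality with constant `C` for the (semi)norm `p`; the expectation is over
uniformly distributed signs. -/
def CotypeIneq {E : Type*} [AddCommGroup E] [Module ℝ E] (p : Seminorm ℝ E) (q C : ℝ) : Prop :=
  ∀ (k : ℕ) (x : Fin k → E),
    (∑ i, p (x i) ^ q) ^ (1 / q) ≤
      C * √((∑ ε : Fin k → ℤˣ, p (∑ i, ((ε i : ℤ) : ℝ) • x i) ^ 2) / 2 ^ k)

/-- The cotype `q` constant: the infimum of the `C ∈ (0, ∞)` in the cotype `q` inequality. -/
noncomputable def cotypeConst {E : Type*} [AddCommGroup E] [Module ℝ E] (p : Seminorm ℝ E)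
    (q : ℝ) : ℝ :=
  sInf {C : ℝ | 0 < C ∧ CotypeIneq p q C}

/-- The space `ℝ^N ⊗ ℝ^N ⊗ ℝ^N`. -/
def TripleTensor (N : ℕ) : Type := (Fin N → ℝ) ⊗[ℝ] (Fin N → ℝ) ⊗[ℝ] (Fin N → ℝ)

noncomputable instance (N : ℕ) : AddCommGroup (TripleTensor N) :=
  TensorProduct.addCommGroup (R := ℝ) (M := (Fin N → ℝ) ⊗[ℝ] (Fin N → ℝ)) (N := Fin N → ℝ)

noncomputable instance (N : ℕ) : Module ℝ (TripleTensor N) :=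
  inferInstanceAs (Module ℝ ((Fin N → ℝ) ⊗[ℝ] (Fin N → ℝ) ⊗[ℝ] (Fin N → ℝ)))

/-- The elementary tensor `e_i ⊗ e_j ⊗ e_k` of standard basis vectors. -/
noncomputable def stdTensor {N : ℕ} (i j k : Fin N) : TripleTensor N :=
  ((Pi.single i 1 : Fin N → ℝ) ⊗ₜ[ℝ] (Pi.single j 1 : Fin N → ℝ)) ⊗ₜ[ℝ]
    (Pi.single k 1 : Fin N → ℝ)

/-- `K`-tensor-symmetry of a (semi)norm on `ℝ^N ⊗ ℝ^N ⊗ ℝ^N`. -/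
def IsTensorSymmetric {N : ℕ} (K : ℝ) (p : Seminorm ℝ (TripleTensor N)) : Prop :=
  ∀ (π σ τ : Equiv.Perm (Fin N)) (ε δ η : Fin N → ℤˣ) (a : Fin N → Fin N → Fin N → ℝ),
    p (∑ i, ∑ j, ∑ k, (((ε i : ℤ) : ℝ) * ((δ j : ℤ) : ℝ) * ((η k : ℤ) : ℝ) *
        a (π i) (σ j) (τ k)) • stdTensor i j k) ≤
      K * p (∑ i, ∑ j, ∑ k, a i j k • stdTensor i j k)

/-!
Let `z(ε) ∈ {-1, 1}^{3n}` be the codeword `C(ε)` followed by `2n` symbols `1`, and consider the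
tensor-valued function `F(ε) = z(ε) ⊗ z(ε) ⊗ z(ε)` on the cube `{-1, 1}^m` with its first-order Walsh
coefficients `y_t = 𝔼 ε_t F(ε)`. The theorem compares two estimates for these.

*Lower bound.* Fix `t`. If few positions of the code are replaced by random signs, the decoder still has
an advantage `2θ`, and its Walsh expansion shows that some set of at most three untouched positions has
correlation at least `θ/5` with `ε_t` (`exists_correlated_set`). A maximal disjoint family of such sets
therefore has more than `φn/3` members (`exists_matching`). With the constant symbols the sets become
triples, on which the coordinates of `y_t` are large, and which are part of the graph of a pair of
permutations (`exists_permutations`). Averaging over signs and permutations turns `y_t` into a multiple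
of `∑ e_i ⊗ e_i ⊗ e_i`, hence `‖y_t‖ ≥ φθ/(45K) · ‖∑ e_i ⊗ e_i ⊗ e_i‖` (`diagonal_le`).

*Upper bound.* By symmetry `‖F(ε)‖ ≤ K‖∑ e_i ⊗ e_j ⊗ e_k‖` for all `ε`. The linear part `∑ ε_t y_t` of
`F` obeys the same bound in `L²` up to a factor `O(log (n + 1))`, as Pisier's estimate for the
`K`-convexity constant predicts (`rademacher_projection_bound`). To see this, express the coefficient
of `ρ` in the polynomial `T_ρ F` by the values of that polynomial in `[-1, 1]`. The noise operators
`T_ρ` are contractions, and by Bernstein's inequality the total weight needed is linear in the degree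
(`exists_first_moment_quadrature`). A degree `L = O(log (n + 1))` is enough, since the higher Walsh
levels contribute a geometrically small error, which is controlled coordinatewise by orthogonality
because `‖e_i ⊗ e_j ⊗ e_k‖ ≤ K‖∑ e_i ⊗ e_j ⊗ e_k‖` (`stdTensor_le`).

The cotype inequality for `y_1, …, y_m` puts the two together. It holds with the infimum
`cotypeConst`, since the set of admissible constants is nonempty in finite dimension
(`cotypeIneq_cotypeConst`).
-/

/-! ### A quadrature rule for the linear coefficient of a polynomial -/

open Complex in
theorem sum_exp_roots_of_unity (Q : ℕ) (k : ℤ) (hk : |k| < Q) :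
    ∑ s : Fin Q, exp (((k : ℂ) * ((2 * Real.pi * (s : ℕ) / Q : ℝ) : ℂ)) * I) =
      if k = 0 then (Q : ℂ) else 0 := by
  split_ifs with h
  · simp [h]
  have hQ0 : Q ≠ 0 := by
    rintro rfl
    exact absurd hk (by simp)
  have hs : ∀ s : ℕ, exp (((k : ℂ) * ((2 * Real.pi * s / Q : ℝ) : ℂ)) * I) =
      (exp (2 * Real.pi * I / Q) ^ k) ^ s := by
    intro s
    rw [← exp_int_mul, ← exp_nat_mul]
    congr 1
    push_cast
    ring
  simp_rw [hs]
  have hζ := isPrimitiveRoot_exp Q hQ0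
  set ζ := exp (2 * Real.pi * I / Q)
  have h1 : ζ ^ k ≠ 1 := by
    rw [Ne, hζ.zpow_eq_one_iff_dvd]
    intro hd
    have := Int.eq_zero_of_abs_lt_dvd hd hk
    exact h this
  rw [Fin.sum_univ_eq_sum_range (fun s => (ζ ^ k) ^ s) Q, geom_sum_eq h1,
    ← zpow_natCast, ← zpow_mul, mul_comm, zpow_mul]
  simp [hζ.pow_eq_one]

theorem card_pairs_with_difference (L k : ℕ) (hk : k ≤ L) :
    ((Finset.range L ×ˢ Finset.range L).filter
      (fun x : ℕ × ℕ => (x.1 : ℤ) - x.2 - L + k = 0)).card = k := by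
  have : ((Finset.range L ×ˢ Finset.range L).filter
      (fun x : ℕ × ℕ => (x.1 : ℤ) - x.2 - L + k = 0)) =
      (Finset.range k).image (fun b => (b + (L - k), b)) := by
    ext ⟨a, b⟩
    simp only [Finset.mem_filter, Finset.mem_product, Finset.mem_range, Finset.mem_image,
      Prod.mk.injEq]
    constructor
    · rintro ⟨h1, h2⟩
      exact ⟨b, by omega, by omega, rfl⟩
    · rintro ⟨c, h1, h2, rfl⟩
      omega
  rw [this, Finset.card_image_of_injective _ (fun a b h => by simpa using h), Finset.card_range]

/-- The `s`-th of `Q` equally spaced angles. -/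
noncomputable def node (Q : ℕ) (s : Fin Q) : ℝ := 2 * Real.pi * (s : ℕ) / Q

open Complex in
/-- The unnormalized Fejér kernel `|∑_{l < L} e^{ilt}|²`; dividing by `L` gives the usual one. -/
noncomputable def fejer (L : ℕ) (t : ℝ) : ℝ := normSq (∑ l ∈ Finset.range L, exp ((l : ℂ) * t * I))

open Complex in
theorem fejer_eq (L : ℕ) (t : ℝ) : (fejer L t : ℂ) =
    ∑ x ∈ Finset.range L ×ˢ Finset.range L, exp ((((x.1 : ℤ) - x.2 : ℤ) : ℂ) * t * I) := by
  rw [fejer, ← mul_conj, map_sum, Finset.sum_mul_sum, Finset.sum_product]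
  refine Finset.sum_congr rfl fun a _ => Finset.sum_congr rfl fun b _ => ?_
  rw [← exp_conj, ← exp_add]
  congr 1
  simp
  ring

open Complex in
theorem sum_fejer (L : ℕ) :
    ∑ s : Fin (4 * L), fejer L (node (4 * L) s) = 4 * L * L := by
  have : ((∑ s : Fin (4 * L), fejer L (node (4 * L) s) : ℝ) : ℂ) = 4 * L * L := by
    push_cast
    simp_rw [fejer_eq]
    rw [Finset.sum_comm]
    have : ∀ x ∈ Finset.range L ×ˢ Finset.range L,
        ∑ s, exp ((((x.1 : ℤ) - x.2 : ℤ) : ℂ) * (node (4 * L) s) * I) =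
        if x.1 = x.2 then (4 * L : ℂ) else 0 := by
      rintro ⟨a, b⟩ hx
      simp only [Finset.mem_product, Finset.mem_range] at hx
      have := sum_exp_roots_of_unity (4 * L) ((a : ℤ) - b) (by push_cast; rw [abs_lt]; omega)
      unfold node
      rw [this]
      push_cast
      simp [sub_eq_zero]
    rw [Finset.sum_congr rfl this, Finset.sum_product]
    simp only [Finset.sum_ite_eq, Finset.mem_range]
    rw [Finset.sum_congr rfl (g := fun _ => (4 * L : ℂ))]
    · simp; ring
    · intro a ha
      simp at ha
      simp [ha]
  exact_mod_cast this

open Complex in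
/-- The measure with density `sin (L t) · fejer L t` on the `4L`-th roots of unity acts on
`e^{ikt}` with `0 ≤ k ≤ L` as `2L` times the derivative at `t = 0`. All frequencies that occur are
smaller than `4L` in absolute value, so that there is no aliasing. -/
theorem fejer_moment_nat (L k : ℕ) (hk : k ≤ L) :
    ∑ s : Fin (4 * L), ((Real.sin (L * node (4 * L) s) * fejer L (node (4 * L) s) : ℝ) : ℂ) *
      exp ((k : ℂ) * node (4 * L) s * I) = 2 * L * (k * I) := by
  have h1 : ∀ s : Fin (4 * L), ((Real.sin (L * node (4 * L) s) * fejer L (node (4 * L) s) : ℝ) : ℂ) *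
      exp ((k : ℂ) * node (4 * L) s * I) =
      ∑ x ∈ Finset.range L ×ˢ Finset.range L,
        (exp ((((x.1 : ℤ) - x.2 - L + k : ℤ) : ℂ) * (node (4 * L) s) * I) -
          exp ((((x.1 : ℤ) - x.2 + L + k : ℤ) : ℂ) * (node (4 * L) s) * I)) * (I / 2) := by
    intro s
    push_cast
    rw [fejer_eq, Complex.sin, Finset.mul_sum, Finset.sum_mul]
    refine Finset.sum_congr rfl fun x _ => ?_
    have e1 : exp (((x.1 : ℂ) - x.2 - L + k) * (node (4 * L) s) * I) =
      exp (-((L : ℂ) * (node (4 * L) s)) * I) *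
        exp ((((x.1 : ℤ) - x.2 : ℤ) : ℂ) * (node (4 * L) s) * I) *
        exp ((k : ℂ) * node (4 * L) s * I) := by
      rw [← exp_add, ← exp_add]; congr 1; push_cast; ring
    have e2 : exp (((x.1 : ℂ) - x.2 + L + k) * (node (4 * L) s) * I) =
      exp (((L : ℂ) * (node (4 * L) s)) * I) *
        exp ((((x.1 : ℤ) - x.2 : ℤ) : ℂ) * (node (4 * L) s) * I) *
        exp ((k : ℂ) * node (4 * L) s * I) := by
      rw [← exp_add, ← exp_add]; congr 1; push_cast; ring
    rw [e1, e2]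
    ring
  simp_rw [h1]
  rw [Finset.sum_comm]
  have h2 : ∀ x ∈ Finset.range L ×ˢ Finset.range L,
      ∑ s, (exp ((((x.1 : ℤ) - x.2 - L + k : ℤ) : ℂ) * (node (4 * L) s) * I) -
          exp ((((x.1 : ℤ) - x.2 + L + k : ℤ) : ℂ) * (node (4 * L) s) * I)) * (I / 2) =
      if (x.1 : ℤ) - x.2 - L + k = 0 then 2 * L * I else 0 := by
    rintro ⟨a, b⟩ hx
    simp only [Finset.mem_product, Finset.mem_range] at hx
    have h3 := sum_exp_roots_of_unity (4 * L) ((a : ℤ) - b - L + k) (by push_cast; rw [abs_lt]; omega)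
    have h4 := sum_exp_roots_of_unity (4 * L) ((a : ℤ) - b + L + k) (by push_cast; rw [abs_lt]; omega)
    rw [if_neg (by omega)] at h4
    rw [← Finset.sum_mul, Finset.sum_sub_distrib]
    unfold node
    rw [h3, h4]
    split_ifs
    · push_cast; ring
    · simp
  rw [Finset.sum_congr rfl h2, ← Finset.sum_filter, Finset.sum_const, card_pairs_with_difference L k hk]
  simp; ring

open Complex in
theorem fejer_moment_int (L : ℕ) (k : ℤ) (hk : |k| ≤ L) :
    ∑ s : Fin (4 * L), ((Real.sin (L * node (4 * L) s) * fejer L (node (4 * L) s) : ℝ) : ℂ) *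
      exp ((k : ℂ) * node (4 * L) s * I) = 2 * L * (k * I) := by
  obtain ⟨j, rfl | rfl⟩ := k.eq_nat_or_neg
  · exact_mod_cast fejer_moment_nat L j (by simpa using hk)
  · have := congrArg (starRingEnd ℂ) (fejer_moment_nat L j (by simpa using hk))
    rw [map_sum] at this
    simp only [map_mul, ← exp_conj, conj_ofReal, conj_I, map_natCast, map_ofNat] at this
    push_cast at this ⊢
    simpa only [neg_mul, mul_neg] using this

open Complex in
/-- On `sin t ^ j` the functional of `fejer_moment_int` is `2L` times the derivative at `t = 0`, because
it is so on the exponentials that `sin t ^ j` is a combination of. -/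
theorem fejer_moment_sin_pow (L j : ℕ) (hj : j ≤ L) :
    ∑ s : Fin (4 * L), Real.sin (L * node (4 * L) s) * fejer L (node (4 * L) s) *
      Real.sin (node (4 * L) s) ^ j = if j = 1 then 2 * (L : ℝ) else 0 := by
  -- binomial expansion of `sin ^ j` in exponentials
  have hexp : ∀ z : ℂ, Complex.sin z ^ j = ∑ a ∈ Finset.range (j + 1),
      ((I / 2) ^ j * (-1) ^ a * (j.choose a : ℂ)) * exp ((((j : ℤ) - 2 * a : ℤ) : ℂ) * -z * I) := by
    intro z
    rw [Complex.sin, sub_eq_neg_add, mul_div_assoc, mul_pow, add_pow, Finset.sum_mul]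
    refine Finset.sum_congr rfl fun a ha => ?_
    have ha' : a ≤ j := by simpa [Nat.lt_succ_iff] using ha
    rw [neg_pow, ← exp_nat_mul, ← exp_nat_mul]
    have : exp ((((j : ℤ) - 2 * a : ℤ) : ℂ) * -z * I) =
      exp (a * (z * I)) * exp (((j - a : ℕ) : ℂ) * (-z * I)) := by
      rw [← exp_add]; congr 1; push_cast [Nat.cast_sub ha']; ring
    rw [this]
    ring
  have hd1 : HasDerivAt (fun z : ℂ => Complex.sin z ^ j) (if j = 1 then 1 else 0) 0 := by
    have := (Complex.hasDerivAt_sin 0).pow j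
    refine this.congr_deriv ?_
    rcases j with _ | _ | j <;> simp
  have hd2 : HasDerivAt (fun z : ℂ => Complex.sin z ^ j) (∑ a ∈ Finset.range (j + 1),
      ((I / 2) ^ j * (-1) ^ a * (j.choose a : ℂ)) * (-(((j : ℤ) - 2 * a : ℤ) : ℂ) * I)) 0 := by
    rw [funext hexp]
    refine HasDerivAt.fun_sum fun a _ => ?_
    refine HasDerivAt.const_mul _ ?_
    have := ((((hasDerivAt_id (0 : ℂ)).neg).const_mul ((((j : ℤ) - 2 * a : ℤ) : ℂ))).mul_const I).cexp
    refine this.congr_deriv ?_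
    simp
  have hd := hd2.unique hd1
  have : ((∑ s : Fin (4 * L), Real.sin (L * node (4 * L) s) * fejer L (node (4 * L) s) *
      Real.sin (node (4 * L) s) ^ j : ℝ) : ℂ) = 2 * L * (if j = 1 then 1 else 0) := by
    rw [← hd, Finset.mul_sum]
    push_cast
    simp_rw [hexp, Finset.mul_sum]
    rw [Finset.sum_comm]
    refine Finset.sum_congr rfl fun a ha => ?_
    have ha' : a ≤ j := by simpa [Nat.lt_succ_iff] using ha
    have := fejer_moment_int L (-((j : ℤ) - 2 * a)) (by rw [abs_le]; omega)
    have h3 : (2 * (L : ℂ)) * (((I / 2) ^ j * (-1) ^ a * (j.choose a : ℂ)) * (-((j : ℂ) - 2 * a) * I)) =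
        ((I / 2) ^ j * (-1) ^ a * (j.choose a : ℂ)) * (2 * (L : ℂ) * (-((j : ℂ) - 2 * a) * I)) := by ring
    push_cast at this
    rw [h3, ← this, Finset.mul_sum]
    refine Finset.sum_congr rfl fun s _ => ?_
    push_cast
    rw [neg_mul_comm]
    ring
  split_ifs at this ⊢ with h
  · have h' : ((∑ s : Fin (4 * L), Real.sin (L * node (4 * L) s) * fejer L (node (4 * L) s) *
      Real.sin (node (4 * L) s) ^ j : ℝ) : ℂ) = ((2 * L : ℝ) : ℂ) := by rw [this]; push_cast; ring
    exact ofReal_injective h'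
  · rw [mul_zero] at this
    exact_mod_cast this

/-- Bernstein's inequality at `0` in dual form: on polynomials `P` of degree at most `L`, the functional
`P'(0)` is a combination of point evaluations in `[-1, 1]` with total weight at most `2L`. -/
theorem exists_first_moment_quadrature (L : ℕ) (hL : 1 ≤ L) :
    ∃ w ρ : Fin (4 * L) → ℝ, ∑ s, |w s| ≤ 2 * L ∧ (∀ s, |ρ s| ≤ 1) ∧
      ∀ j ≤ L, ∑ s, w s * ρ s ^ j = if j = 1 then 1 else 0 := by
  have hL0 : (0 : ℝ) < L := by exact_mod_cast hL
  refine ⟨fun s => (2 * (L : ℝ))⁻¹ * (Real.sin (L * node (4 * L) s) * fejer L (node (4 * L) s)),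
    fun s => Real.sin (node (4 * L) s), ?_, fun s => Real.abs_sin_le_one _, fun j hj => ?_⟩
  · calc _ ≤ ∑ s, (2 * (L : ℝ))⁻¹ * fejer L (node (4 * L) s) := by
          refine Finset.sum_le_sum fun s _ => ?_
          have hF : 0 ≤ fejer L (node (4 * L) s) := Complex.normSq_nonneg _
          rw [abs_mul, abs_mul, abs_of_nonneg hF, abs_of_nonneg (by positivity : (0:ℝ) ≤ (2 * (L : ℝ))⁻¹)]
          gcongr
          exact mul_le_of_le_one_left hF (Real.abs_sin_le_one _)
      _ = 2 * L := by
          rw [← Finset.mul_sum, sum_fejer L]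
          field_simp
          ring
  · simp_rw [mul_assoc (2 * (L : ℝ))⁻¹]
    rw [← Finset.mul_sum, fejer_moment_sin_pow L j hj]
    split_ifs
    · field_simp
    · simp

/-! ### Walsh functions and the Rademacher projection -/

/-- The sign `u ∈ {-1, 1}` as a real number. -/
abbrev sgn (u : ℤˣ) : ℝ := ((u : ℤ) : ℝ)

theorem sgn_mul_self (u : ℤˣ) : sgn u * sgn u = 1 := by
  rcases Int.units_eq_one_or u with rfl | rfl <;> simp [sgn]

theorem abs_sgn (u : ℤˣ) : |sgn u| = 1 := by
  rcases Int.units_eq_one_or u with rfl | rfl <;> simp [sgn]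

theorem sum_sgn : ∑ u : ℤˣ, sgn u = 0 := by
  simp [sgn, UnitsInt.univ]

theorem seminorm_sum_le {E ι : Type*} [AddCommGroup E] [Module ℝ E] (p : Seminorm ℝ E)
    (s : Finset ι) (x : ι → E) : p (∑ i ∈ s, x i) ≤ ∑ i ∈ s, p (x i) :=
  Finset.le_sum_of_subadditive p (map_zero p).le (map_add_le_add p) s x

theorem card_cube (m : ℕ) : Fintype.card (Fin m → ℤˣ) = 2 ^ m := by simp

/-- The Walsh function `ε ↦ ∏_{t ∈ A} ε_t`. -/
noncomputable def walsh {m : ℕ} (A : Finset (Fin m)) (ε : Fin m → ℤˣ) : ℝ := ∏ t ∈ A, sgn (ε t)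

/-- The Walsh coefficient `𝔼 w_A f` of `f`, over uniform signs. -/
noncomputable def walshCoeff {m : ℕ} (f : (Fin m → ℤˣ) → ℝ) (A : Finset (Fin m)) : ℝ :=
  (∑ ε, walsh A ε * f ε) / 2 ^ m

theorem abs_walsh {m : ℕ} (A : Finset (Fin m)) (ε : Fin m → ℤˣ) : |walsh A ε| = 1 := by
  simp [walsh, Finset.abs_prod, abs_sgn]

theorem sum_walsh {m : ℕ} (A : Finset (Fin m)) :
    ∑ ε, walsh A ε = if A = ∅ then 2 ^ m else 0 := by
  split_ifs with h
  · simp [walsh, h]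
  have h1 : ∀ ε : Fin m → ℤˣ, walsh A ε = ∏ t, if t ∈ A then sgn (ε t) else 1 := by
    intro ε
    rw [walsh, Finset.prod_ite_mem, Finset.univ_inter]
  simp_rw [h1]
  rw [← Fintype.prod_sum (fun (t : Fin m) (u : ℤˣ) => if t ∈ A then sgn u else 1)]
  obtain ⟨t, ht⟩ := Finset.nonempty_iff_ne_empty.mpr h
  refine Finset.prod_eq_zero (Finset.mem_univ t) ?_
  simp only [ht, if_true]
  exact sum_sgn

theorem walsh_mul_walsh {m : ℕ} (A B : Finset (Fin m)) (ε : Fin m → ℤˣ) :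
    walsh A ε * walsh B ε = walsh (symmDiff A B) ε := by
  have h1 : ∀ (A : Finset (Fin m)), walsh A ε = ∏ t, if t ∈ A then sgn (ε t) else 1 := by
    intro A
    rw [walsh, Finset.prod_ite_mem, Finset.univ_inter]
  rw [h1, h1, h1, ← Finset.prod_mul_distrib]
  refine Finset.prod_congr rfl fun t _ => ?_
  by_cases ha : t ∈ A <;> by_cases hb : t ∈ B <;> simp [Finset.mem_symmDiff, ha, hb, sgn_mul_self]

theorem sum_walsh_mul_walsh {m : ℕ} (A B : Finset (Fin m)) :
    ∑ ε, walsh A ε * walsh B ε = if A = B then 2 ^ m else 0 := by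
  simp_rw [walsh_mul_walsh]
  rw [sum_walsh]
  simp only [← Finset.bot_eq_empty, symmDiff_eq_bot]

theorem sum_sq_walsh_expansion {m : ℕ} (c : Finset (Fin m) → ℝ) :
    ∑ ε, (∑ A, c A * walsh A ε) ^ 2 = 2 ^ m * ∑ A, c A ^ 2 := by
  simp_rw [sq, Finset.sum_mul_sum]
  rw [Finset.sum_comm, Finset.mul_sum]
  refine Finset.sum_congr rfl fun A _ => ?_
  rw [Finset.sum_comm]
  have : ∀ B, ∑ ε, c A * walsh A ε * (c B * walsh B ε) = if A = B then 2 ^ m * (c A * c B) else 0 := by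
    intro B
    have := sum_walsh_mul_walsh A B
    calc _ = c A * c B * ∑ ε, walsh A ε * walsh B ε := by
          rw [Finset.mul_sum]; exact Finset.sum_congr rfl fun ε _ => by ring
      _ = _ := by rw [this]; split_ifs <;> ring
  simp_rw [this]
  simp

/-- Walsh expansion of the kernel of the noise operator `T_ρ`. -/
theorem prod_one_add_eq_sum_walsh {m : ℕ} (ρ : ℝ) (ε δ : Fin m → ℤˣ) :
    ∏ t, (1 + ρ * (sgn (ε t) * sgn (δ t))) = ∑ A, ρ ^ A.card * walsh A ε * walsh A δ := by
  rw [Finset.prod_one_add, Finset.powerset_univ]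
  refine Finset.sum_congr rfl fun A _ => ?_
  rw [Finset.prod_mul_distrib, Finset.prod_const, Finset.prod_mul_distrib, walsh, walsh, mul_assoc]

theorem sum_prod_one_add {m : ℕ} (ρ : ℝ) (ε : Fin m → ℤˣ) :
    ∑ δ : Fin m → ℤˣ, ∏ t, (1 + ρ * (sgn (ε t) * sgn (δ t))) = 2 ^ m := by
  rw [← Fintype.prod_sum (fun (t : Fin m) (u : ℤˣ) => 1 + ρ * (sgn (ε t) * sgn u))]
  have : ∀ t : Fin m, ∑ u : ℤˣ, (1 + ρ * (sgn (ε t) * sgn u)) = 2 := by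
    intro t
    rw [Finset.sum_add_distrib, ← Finset.mul_sum, ← Finset.mul_sum, sum_sgn]
    simp
  simp_rw [this]
  simp

/-- Bessel's inequality for the Walsh system. -/
theorem sum_walshCoeff_sq {m : ℕ} (f : (Fin m → ℤˣ) → ℝ) :
    2 ^ m * ∑ A, walshCoeff f A ^ 2 ≤ ∑ ε, f ε ^ 2 := by
  have h0 : 0 ≤ ∑ ε, (f ε - ∑ A, walshCoeff f A * walsh A ε) ^ 2 :=
    Finset.sum_nonneg fun _ _ => sq_nonneg _
  have h1 : ∑ ε, f ε * ∑ A, walshCoeff f A * walsh A ε = 2 ^ m * ∑ A, walshCoeff f A ^ 2 := by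
    simp_rw [Finset.mul_sum]
    rw [Finset.sum_comm]
    refine Finset.sum_congr rfl fun A _ => ?_
    have : ∑ ε, walsh A ε * f ε = 2 ^ m * walshCoeff f A := by
      rw [walshCoeff]; field_simp
    rw [sq, ← mul_assoc, ← this, Finset.sum_mul]
    exact Finset.sum_congr rfl fun ε _ => by ring
  have h2 := sum_sq_walsh_expansion (walshCoeff f)
  have h3 : ∑ ε, (f ε - ∑ A, walshCoeff f A * walsh A ε) ^ 2 =
      ∑ ε, f ε ^ 2 - 2 * ∑ ε, f ε * ∑ A, walshCoeff f A * walsh A ε +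
        ∑ ε, (∑ A, walshCoeff f A * walsh A ε) ^ 2 := by
    rw [Finset.mul_sum, ← Finset.sum_sub_distrib, ← Finset.sum_add_distrib]
    exact Finset.sum_congr rfl fun ε _ => by ring
  rw [h1, h2] at h3
  linarith

/-- The noise operator `T_ρ` does not increase the sup norm of vector-valued functions: its kernel is
a probability density for `|ρ| ≤ 1`. -/
theorem seminorm_noise_le {E : Type*} [AddCommGroup E] [Module ℝ E] (p : Seminorm ℝ E) {m : ℕ}
    (F : (Fin m → ℤˣ) → E) (M : ℝ) (hF : ∀ ε, p (F ε) ≤ M) (ρ : ℝ) (hρ : |ρ| ≤ 1)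
    (ε : Fin m → ℤˣ) :
    p (∑ δ, ((∏ t, (1 + ρ * (sgn (ε t) * sgn (δ t)))) / 2 ^ m) • F δ) ≤ M := by
  have hnn : ∀ δ : Fin m → ℤˣ, 0 ≤ (∏ t, (1 + ρ * (sgn (ε t) * sgn (δ t)))) / 2 ^ m := by
    intro δ
    refine div_nonneg (Finset.prod_nonneg fun t _ => ?_) (by positivity)
    have : |ρ * (sgn (ε t) * sgn (δ t))| ≤ 1 := by
      rw [abs_mul, abs_mul, abs_sgn, abs_sgn]; simpa using hρ
    linarith [(abs_le.mp this).1]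
  calc _ ≤ ∑ δ, p (((∏ t, (1 + ρ * (sgn (ε t) * sgn (δ t)))) / 2 ^ m) • F δ) := seminorm_sum_le p _ _
    _ ≤ ∑ δ : Fin m → ℤˣ, (∏ t, (1 + ρ * (sgn (ε t) * sgn (δ t)))) / 2 ^ m * M := by
        refine Finset.sum_le_sum fun δ _ => ?_
        rw [map_smul_eq_mul, Real.norm_of_nonneg (hnn δ)]
        exact mul_le_mul_of_nonneg_left (hF δ) (hnn δ)
    _ = M := by
        rw [← Finset.sum_mul, ← Finset.sum_div, sum_prod_one_add]
        field_simp

/-- A logarithmic `K`-convexity estimate. Let `F = ∑ i, f i • e i` be a function on the cube with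
`p ∘ F ≤ M`, with coordinates `f i` bounded by `1` and with `p (e i) ≤ M`. If there are at most `2 ^ L`
coordinates, then the linear part of `F` has `L²`-norm at most `8 * L * M`. -/
theorem rademacher_projection_bound {E ι : Type*} [AddCommGroup E] [Module ℝ E] [Fintype ι]
    (p : Seminorm ℝ E) {m : ℕ} (e : ι → E) (f : ι → (Fin m → ℤˣ) → ℝ) (M : ℝ) (hM : 0 ≤ M) (L : ℕ)
    (hL : 1 ≤ L) (hf : ∀ i ε, |f i ε| ≤ 1) (hF : ∀ ε, p (∑ i, f i ε • e i) ≤ M)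
    (he : ∀ i, p (e i) ≤ M) (hι : Fintype.card ι ≤ 2 ^ L) :
    (∑ ε : Fin m → ℤˣ, p (∑ t, sgn (ε t) • ∑ i, walshCoeff (f i) {t} • e i) ^ 2) / 2 ^ m ≤
      (8 * L * M) ^ 2 := by
  obtain ⟨w, ρ, hw, hρ, hmom⟩ := exists_first_moment_quadrature L hL
  -- The operator `∑ s, 2 w_s T_{ρ_s / 2}` multiplies the `k`-th Walsh level by `γ k`. For `k ≤ L` this
  -- is `1` if `k = 1` and `0` otherwise; the factor `1 / 2` in the noise makes `γ` small for `k > L`.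
  set γ : ℕ → ℝ := fun k => ∑ s, 2 * w s * (ρ s / 2) ^ k with hγ
  set T : (Fin m → ℤˣ) → Fin (4 * L) → E := fun ε s =>
    ∑ δ, ((∏ t, (1 + (ρ s / 2) * (sgn (ε t) * sgn (δ t)))) / 2 ^ m) • ∑ i, f i δ • e i with hT
  set c : ι → Finset (Fin m) → ℝ :=
    fun i A => (if A.card ≤ L then 0 else γ A.card) * walshCoeff (f i) A with hc
  have hγ1 : ∀ k ≤ L, γ k = if k = 1 then 1 else 0 := by
    intro k hk
    have : γ k = 2 / 2 ^ k * ∑ s, w s * ρ s ^ k := by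
      rw [hγ, Finset.mul_sum]
      refine Finset.sum_congr rfl fun s _ => ?_
      rw [div_pow]; ring
    rw [this, hmom k hk]
    split_ifs with h
    · simp [h]
    · simp
  have hγ2 : ∀ k, L < k → |γ k| ≤ 4 * L / 2 ^ L := by
    intro k hk
    calc |γ k| ≤ ∑ s, |2 * w s * (ρ s / 2) ^ k| := Finset.abs_sum_le_sum_abs _ _
      _ ≤ ∑ s, |w s| * (2 / 2 ^ L) := by
          refine Finset.sum_le_sum fun s _ => ?_
          rw [abs_mul, abs_mul, abs_pow, abs_div, abs_two]
          have : (|ρ s| / 2) ^ k ≤ 1 / 2 ^ L := by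
            calc (|ρ s| / 2) ^ k ≤ (1 / 2) ^ k := by gcongr; exact hρ s
              _ ≤ (1 / 2) ^ L := pow_le_pow_of_le_one (by norm_num) (by norm_num) hk.le
              _ = 1 / 2 ^ L := by rw [div_pow, one_pow]
          calc 2 * |w s| * (|ρ s| / 2) ^ k ≤ 2 * |w s| * (1 / 2 ^ L) := by gcongr
            _ = _ := by ring
      _ ≤ 2 * L * (2 / 2 ^ L) := by rw [← Finset.sum_mul]; gcongr
      _ = _ := by ring
  have hmain : ∀ ε, p (∑ s, (2 * w s) • T ε s) ≤ 4 * L * M := by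
    intro ε
    calc _ ≤ ∑ s, p ((2 * w s) • T ε s) := seminorm_sum_le p _ _
      _ ≤ ∑ s, |w s| * (2 * M) := by
          refine Finset.sum_le_sum fun s _ => ?_
          rw [map_smul_eq_mul, Real.norm_eq_abs, abs_mul, abs_two]
          have : p (T ε s) ≤ M := seminorm_noise_le p _ M hF (ρ s / 2) (by
            rw [abs_div, abs_two]; linarith [hρ s]) ε
          calc 2 * |w s| * p (T ε s) ≤ 2 * |w s| * M := by gcongr
            _ = _ := by ring
      _ ≤ 2 * L * (2 * M) := by rw [← Finset.sum_mul]; gcongr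
      _ = _ := by ring
  have hTwalsh : ∀ ε, ∑ s, (2 * w s) • T ε s =
      ∑ i, (∑ A, γ A.card * walshCoeff (f i) A * walsh A ε) • e i := by
    intro ε
    simp_rw [hT, Finset.smul_sum, smul_smul]
    rw [Finset.sum_comm, Finset.sum_congr rfl (fun _ _ => Finset.sum_comm), Finset.sum_comm]
    refine Finset.sum_congr rfl fun i _ => ?_
    simp_rw [← Finset.sum_smul]
    congr 1
    simp_rw [prod_one_add_eq_sum_walsh, walshCoeff, hγ, Finset.sum_div, Finset.sum_mul, Finset.mul_sum, Finset.sum_mul]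
    rw [Finset.sum_comm, Finset.sum_congr rfl (fun _ _ => Finset.sum_comm), Finset.sum_comm]
    refine Finset.sum_congr rfl fun A _ => Finset.sum_congr rfl fun s _ =>
      Finset.sum_congr rfl fun δ _ => ?_
    ring
  have hdecomp : ∀ ε : Fin m → ℤˣ, ∑ t, sgn (ε t) • ∑ i, walshCoeff (f i) {t} • e i =
      ∑ s, (2 * w s) • T ε s - ∑ i, (∑ A, c i A * walsh A ε) • e i := by
    intro ε
    rw [hTwalsh, ← Finset.sum_sub_distrib]
    simp_rw [← sub_smul, Finset.smul_sum, smul_smul]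
    rw [Finset.sum_comm]
    refine Finset.sum_congr rfl fun i _ => ?_
    rw [← Finset.sum_smul]
    congr 1
    rw [← Finset.sum_sub_distrib]
    have h1 : ∀ A : Finset (Fin m), γ A.card * walshCoeff (f i) A * walsh A ε - c i A * walsh A ε =
        if A ∈ Finset.univ.image (fun t : Fin m => ({t} : Finset (Fin m))) then
          walshCoeff (f i) A * walsh A ε else 0 := by
      intro A
      have hmem : A ∈ Finset.univ.image (fun t : Fin m => ({t} : Finset (Fin m))) ↔ A.card = 1 := by
        simp [Finset.card_eq_one, eq_comm]
      rw [hc]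
      by_cases hA : A.card ≤ L
      · simp only [hA, if_true, hmem, hγ1 _ hA]
        split_ifs <;> simp
      · have : A.card ≠ 1 := by omega
        simp [hA, hmem, this]
    rw [Finset.sum_congr rfl (fun A _ => h1 A), Finset.sum_ite_mem, Finset.univ_inter,
      Finset.sum_image (fun a _ b _ h => by simpa using h)]
    refine Finset.sum_congr rfl fun t _ => ?_
    simp [walsh, mul_comm]
  -- The triangle inequality over the at most `2 ^ L` coordinates, with Cauchy–Schwarz and Bessel, loses
  -- no more than the factor `2 ^ L` that `hγ2` gains.
  have htail : ∑ ε : Fin m → ℤˣ, p (∑ i, (∑ A, c i A * walsh A ε) • e i) ^ 2 ≤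
      2 ^ m * (4 * L * M) ^ 2 := by
    have h1 : ∀ ε : Fin m → ℤˣ, p (∑ i, (∑ A, c i A * walsh A ε) • e i) ^ 2 ≤
        M ^ 2 * (2 ^ L * ∑ i, (∑ A, c i A * walsh A ε) ^ 2) := by
      intro ε
      have : p (∑ i, (∑ A, c i A * walsh A ε) • e i) ≤ M * ∑ i, |∑ A, c i A * walsh A ε| := by
        refine (seminorm_sum_le p _ _).trans ?_
        rw [Finset.mul_sum]
        refine Finset.sum_le_sum fun i _ => ?_
        rw [map_smul_eq_mul, Real.norm_eq_abs, mul_comm]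
        gcongr
        exact he i
      calc _ ≤ (M * ∑ i, |∑ A, c i A * walsh A ε|) ^ 2 := by gcongr
        _ = M ^ 2 * (∑ i, |∑ A, c i A * walsh A ε|) ^ 2 := by ring
        _ ≤ M ^ 2 * (2 ^ L * ∑ i, (∑ A, c i A * walsh A ε) ^ 2) := by
          gcongr
          refine (sq_sum_le_card_mul_sum_sq).trans ?_
          simp_rw [sq_abs]
          gcongr
          exact_mod_cast hι
    have h2 : ∀ i, ∑ ε, (∑ A, c i A * walsh A ε) ^ 2 ≤ 2 ^ m * (4 * L / 2 ^ L) ^ 2 := by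
      intro i
      rw [sum_sq_walsh_expansion]
      calc 2 ^ m * ∑ A, c i A ^ 2 ≤ 2 ^ m * ∑ A, (4 * L / 2 ^ L) ^ 2 * walshCoeff (f i) A ^ 2 := by
            gcongr with A
            rw [hc, mul_pow]
            gcongr ?_ * _
            split_ifs with h
            · rw [zero_pow two_ne_zero]
              positivity
            · rw [← sq_abs]
              have := hγ2 A.card (by omega)
              gcongr
        _ = (4 * L / 2 ^ L) ^ 2 * (2 ^ m * ∑ A, walshCoeff (f i) A ^ 2) := by
            rw [← Finset.mul_sum]; ring
        _ ≤ (4 * L / 2 ^ L) ^ 2 * ∑ ε, f i ε ^ 2 := by gcongr; exact sum_walshCoeff_sq _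
        _ ≤ (4 * L / 2 ^ L) ^ 2 * ∑ ε : Fin m → ℤˣ, 1 := by
            gcongr with ε
            exact (sq_le_one_iff_abs_le_one _).mpr (hf i ε)
        _ = _ := by simp; ring
    calc _ ≤ ∑ ε, M ^ 2 * (2 ^ L * ∑ i, (∑ A, c i A * walsh A ε) ^ 2) :=
          Finset.sum_le_sum fun ε _ => h1 ε
      _ = M ^ 2 * (2 ^ L * ∑ i, ∑ ε, (∑ A, c i A * walsh A ε) ^ 2) := by
          rw [← Finset.mul_sum, ← Finset.mul_sum, Finset.sum_comm]
      _ ≤ M ^ 2 * (2 ^ L * ∑ _i : ι, (2 : ℝ) ^ m * (4 * L / 2 ^ L) ^ 2) := by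
          gcongr with i
          exact h2 i
      _ = M ^ 2 * (2 ^ L * (Fintype.card ι * (2 ^ m * (4 * L / 2 ^ L) ^ 2))) := by simp
      _ ≤ M ^ 2 * (2 ^ L * (2 ^ L * (2 ^ m * (4 * L / 2 ^ L) ^ 2))) := by
          gcongr
          exact_mod_cast hι
      _ = _ := by field_simp
  rw [div_le_iff₀ (by positivity)]
  calc _ ≤ ∑ ε : Fin m → ℤˣ, (2 * (4 * L * M) ^ 2 +
        2 * p (∑ i, (∑ A, c i A * walsh A ε) • e i) ^ 2) := by
        refine Finset.sum_le_sum fun ε _ => ?_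
        rw [hdecomp]
        have h1 := map_sub_le_add p (∑ s, (2 * w s) • T ε s) (∑ i, (∑ A, c i A * walsh A ε) • e i)
        have h2 := hmain ε
        set x := p (∑ i, (∑ A, c i A * walsh A ε) • e i)
        calc _ ≤ (4 * L * M + x) ^ 2 := by
              gcongr
              linarith
          _ ≤ _ := by nlinarith [sq_nonneg (4 * L * M - x)]
    _ ≤ 2 ^ m * (2 * (4 * L * M) ^ 2) + 2 * (2 ^ m * (4 * L * M) ^ 2) := by
        rw [Finset.sum_add_distrib, Finset.sum_const, Finset.card_univ, card_cube, nsmul_eq_mul,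
          ← Finset.mul_sum]
        push_cast
        linarith
    _ = _ := by ring

/-! ### Matchings from a locally decodable code -/

theorem prod_one_add_sgn {m : ℕ} (ε δ : Fin m → ℤˣ) :
    ∏ t, (1 + sgn (ε t) * sgn (δ t)) = if δ = ε then 2 ^ m else 0 := by
  split_ifs with h
  · subst h
    simp_rw [sgn_mul_self]
    norm_num
  · obtain ⟨t, ht⟩ := Function.ne_iff.mp h
    refine Finset.prod_eq_zero (Finset.mem_univ t) ?_
    rcases Int.units_eq_one_or (δ t) with h1 | h1 <;>
      rcases Int.units_eq_one_or (ε t) with h2 | h2 <;> simp_all [sgn]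

theorem walsh_inversion {m : ℕ} (f : (Fin m → ℤˣ) → ℝ) (ε : Fin m → ℤˣ) :
    ∑ A, walshCoeff f A * walsh A ε = f ε := by
  have h1 : ∀ δ : Fin m → ℤˣ, ∑ A, walsh A ε * walsh A δ = if δ = ε then 2 ^ m else 0 := by
    intro δ
    have := prod_one_add_eq_sum_walsh 1 ε δ
    simp only [one_mul, one_pow] at this
    rw [← this, prod_one_add_sgn]
  calc _ = ∑ δ, (∑ A, walsh A ε * walsh A δ) * (f δ / 2 ^ m) := by
        simp_rw [walshCoeff, Finset.sum_div, Finset.sum_mul]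
        rw [Finset.sum_comm]
        exact Finset.sum_congr rfl fun δ _ => Finset.sum_congr rfl fun A _ => by ring
    _ = f ε := by
        simp_rw [h1]
        simp
        field_simp

theorem abs_walshCoeff_le_one {m : ℕ} (f : (Fin m → ℤˣ) → ℝ) (hf : ∀ ε, |f ε| ≤ 1)
    (A : Finset (Fin m)) : |walshCoeff f A| ≤ 1 := by
  rw [walshCoeff, abs_div, div_le_one (by positivity)]
  calc _ ≤ ∑ ε, |walsh A ε * f ε| := Finset.abs_sum_le_sum_abs _ _
    _ ≤ ∑ ε : Fin m → ℤˣ, 1 := by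
        refine Finset.sum_le_sum fun ε _ => ?_
        rw [abs_mul, abs_walsh, one_mul]
        exact hf ε
    _ = |2 ^ m| := by simp

/-- A product of queried symbols is a Walsh function on at most as many positions; repeated queries of
a position cancel in pairs. -/
theorem exists_walsh_eq_prod {n q : ℕ} (idx : Fin q → Fin n) (A : Finset (Fin q)) :
    ∃ S : Finset (Fin n), S.card ≤ A.card ∧
      ∀ δ : Fin n → ℤˣ, walsh A (fun a => δ (idx a)) = walsh S δ := by
  classical
  induction A using Finset.induction_on with
  | empty => exact ⟨∅, by simp, fun δ => by simp [walsh]⟩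
  | insert a A ha ih =>
    obtain ⟨S, hS, h⟩ := ih
    refine ⟨symmDiff {idx a} S, ?_, fun δ => ?_⟩
    · rw [Finset.card_insert_of_notMem ha]
      have : (symmDiff {idx a} S).card ≤ ({idx a} ∪ S).card :=
        Finset.card_le_card (Finset.symmDiff_subset_union)
      have h2 := Finset.card_union_le {idx a} S
      rw [Finset.card_singleton] at h2
      omega
    · rw [← walsh_mul_walsh, ← h δ, walsh, Finset.prod_insert ha]
      simp [walsh]

/-- The correlation `𝔼 ε_t ∏_{i ∈ S} C(ε)_i` of a set of code positions with the message
coordinate `t`. -/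
noncomputable def messageCorr {m n : ℕ} (C : (Fin m → ℤˣ) → (Fin n → ℤˣ)) (t : Fin m)
    (S : Finset (Fin n)) : ℝ :=
  walshCoeff (fun ε => walsh S (C ε)) {t}

/-- Replacing the code symbols on `V` by independent uniform signs removes the correlations of all
sets that meet `V` and keeps the others. -/
theorem sum_sum_corrupted {m n : ℕ} (C : (Fin m → ℤˣ) → (Fin n → ℤˣ)) (t : Fin m)
    (V S : Finset (Fin n)) :
    ∑ ε, ∑ ξ : Fin n → ℤˣ, sgn (ε t) * walsh S (fun i => if i ∈ V then ξ i else C ε i) =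
      if Disjoint S V then 2 ^ m * 2 ^ n * messageCorr C t S else 0 := by
  have h1 : ∀ (ε : Fin m → ℤˣ) (ξ : Fin n → ℤˣ),
      walsh S (fun i => if i ∈ V then ξ i else C ε i) =
        walsh (S.filter (· ∈ V)) ξ * walsh (S.filter (· ∉ V)) (C ε) := by
    intro ε ξ
    rw [walsh, ← Finset.prod_filter_mul_prod_filter_not S (· ∈ V), walsh, walsh]
    congr 1 <;> refine Finset.prod_congr rfl fun i hi => ?_ <;> simp_all
  have h2 : ∀ ε : Fin m → ℤˣ,
      ∑ ξ : Fin n → ℤˣ, sgn (ε t) * walsh S (fun i => if i ∈ V then ξ i else C ε i) =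
      (if S.filter (· ∈ V) = ∅ then 2 ^ n else 0) *
        (sgn (ε t) * walsh (S.filter (· ∉ V)) (C ε)) := by
    intro ε
    rw [← sum_walsh, Finset.sum_mul]
    refine Finset.sum_congr rfl fun ξ _ => ?_
    rw [h1]; ring
  simp_rw [h2]
  have hiff : S.filter (· ∈ V) = ∅ ↔ Disjoint S V := by
    rw [Finset.disjoint_left, Finset.filter_eq_empty_iff]
  rw [← Finset.mul_sum]
  by_cases h : Disjoint S V
  · rw [if_pos h, if_pos (hiff.mpr h)]
    have : S.filter (· ∉ V) = S :=
      Finset.filter_true_of_mem fun i hi => Finset.disjoint_left.mp h hi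
    rw [this, messageCorr, walshCoeff]
    simp only [walsh, Finset.prod_singleton]
    field_simp
  · rw [if_neg h, if_neg (mt hiff.mp h), zero_mul]

theorem ite_eq_units (x y : ℤˣ) : (if x = y then (1 : ℝ) else 0) = (1 + sgn x * sgn y) / 2 := by
  rcases Int.units_eq_one_or x with rfl | rfl <;> rcases Int.units_eq_one_or y with rfl | rfl <;>
    norm_num [sgn]

/-- Outside any set `V` that the code allows to be corrupted there is a set of at most three positions
that is correlated with `ε_t`: otherwise the decoder has too small an advantage on the word whose
symbols on `V` are random. -/
theorem exists_correlated_set {m n : ℕ} {φ θ : ℝ} (hθ : 0 < θ)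
    {C : (Fin m → ℤˣ) → (Fin n → ℤˣ)} (hC : IsThreeQueryLDC φ θ C) (t : Fin m)
    (V : Finset (Fin n)) (hV : (V.card : ℝ) ≤ φ * n) :
    ∃ S : Finset (Fin n), S.card ≤ 3 ∧ Disjoint S V ∧ θ / 5 ≤ |messageCorr C t S| := by
  classical
  -- A query set has at most 8 Walsh characters, each of which would contribute less than `θ / 5`, while
  -- the decoder has advantage `2 * θ`.
  by_contra! hcon
  obtain ⟨A, hA⟩ := hC t
  set Δ : (Fin m → ℤˣ) → (Fin n → ℤˣ) → (Fin n → ℤˣ) :=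
    fun ε ξ i => if i ∈ V then ξ i else C ε i with hΔ
  set T : ℝ := 2 ^ m * 2 ^ n with hT
  have hT0 : 0 < T := by positivity
  have hwalsh : ∀ S : Finset (Fin n), S.card ≤ 3 →
      |∑ ε, ∑ ξ, sgn (ε t) * walsh S (Δ ε ξ)| ≤ T * (θ / 5) := by
    intro S hS
    rw [hΔ, sum_sum_corrupted]
    split_ifs with h
    · rw [abs_mul, abs_of_pos hT0]
      exact mul_le_mul_of_nonneg_left (hcon S hS h).le hT0.le
    · rw [abs_zero]; positivity
  have hquery : ∀ s : Fin n × Fin n × Fin n × (ℤˣ → ℤˣ → ℤˣ → ℤˣ),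
      ∑ ε, ∑ ξ, sgn (s.2.2.2 (Δ ε ξ s.1) (Δ ε ξ s.2.1) (Δ ε ξ s.2.2.1)) * sgn (ε t) ≤
        T * (8 * θ / 5) := by
    rintro ⟨i, j, k, g⟩
    set G : (Fin 3 → ℤˣ) → ℝ := fun x => sgn (g (x 0) (x 1) (x 2)) with hG
    set idx : Fin 3 → Fin n := ![i, j, k] with hidx
    have h1 : ∀ δ : Fin n → ℤˣ, sgn (g (δ i) (δ j) (δ k)) =
        ∑ B, walshCoeff G B * walsh B (fun a => δ (idx a)) := by
      intro δ
      rw [walsh_inversion]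
      simp [hG, hidx]
    have h2 : ∀ B : Finset (Fin 3),
        walshCoeff G B * ∑ ε, ∑ ξ, sgn (ε t) * walsh B (fun a => Δ ε ξ (idx a)) ≤ T * (θ / 5) := by
      intro B
      obtain ⟨S, hS, hSB⟩ := exists_walsh_eq_prod idx B
      have hB : B.card ≤ 3 := by simpa using Finset.card_le_univ B
      simp_rw [hSB]
      refine (le_abs_self _).trans ?_
      rw [abs_mul]
      calc _ ≤ 1 * (T * (θ / 5)) := by
            gcongr
            · exact abs_walshCoeff_le_one G (fun x => (abs_sgn _).le) B
            · exact hwalsh S (hS.trans hB)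
        _ = _ := one_mul _
    calc _ = ∑ B, walshCoeff G B * ∑ ε, ∑ ξ, sgn (ε t) * walsh B (fun a => Δ ε ξ (idx a)) := by
          simp only [h1, Finset.mul_sum, Finset.sum_mul]
          rw [Finset.sum_congr rfl (fun _ _ => Finset.sum_comm), Finset.sum_comm]
          refine Finset.sum_congr rfl fun B _ => Finset.sum_congr rfl fun ε _ =>
            Finset.sum_congr rfl fun ξ _ => by ring
      _ ≤ ∑ _B : Finset (Fin 3), T * (θ / 5) := Finset.sum_le_sum fun B _ => h2 B
      _ = _ := by simp; ring
  have hsum : ∑ s, (A s).toReal = 1 := by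
    rw [← ENNReal.toReal_sum (fun s _ => A.apply_ne_top s), ← tsum_fintype (L := .unconditional _),
      A.tsum_coe, ENNReal.toReal_one]
  have hpoint : ∀ (ε : Fin m → ℤˣ) (ξ : Fin n → ℤˣ), 2 * θ ≤ ∑ s, (A s).toReal *
      (sgn (s.2.2.2 (Δ ε ξ s.1) (Δ ε ξ s.2.1) (Δ ε ξ s.2.2.1)) * sgn (ε t)) := by
    intro ε ξ
    have hd : hammingDist (Δ ε ξ) (C ε) ≤ V.card := by
      refine Finset.card_le_card fun i hi => ?_
      by_contra hiV
      simp [hΔ, hiV] at hi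
    have := hA ε (Δ ε ξ) (le_trans (by exact_mod_cast hd) hV)
    rw [PMF.toOuterMeasure_apply_fintype, ENNReal.toReal_sum] at this
    · have h2 : ∀ s : Fin n × Fin n × Fin n × (ℤˣ → ℤˣ → ℤˣ → ℤˣ),
          (Set.indicator {s : Fin n × Fin n × Fin n × (ℤˣ → ℤˣ → ℤˣ → ℤˣ) |
            s.2.2.2 (Δ ε ξ s.1) (Δ ε ξ s.2.1) (Δ ε ξ s.2.2.1) = ε t} A s).toReal =
          (A s).toReal * ((1 + sgn (s.2.2.2 (Δ ε ξ s.1) (Δ ε ξ s.2.1) (Δ ε ξ s.2.2.1)) *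
            sgn (ε t)) / 2) := by
        intro s
        rw [← ite_eq_units, Set.indicator_apply]
        simp only [Set.mem_ofPred_eq]
        split_ifs <;> simp
      rw [Finset.sum_congr rfl fun s _ => h2 s] at this
      have h3 : ∑ s, (A s).toReal * ((1 + sgn (s.2.2.2 (Δ ε ξ s.1) (Δ ε ξ s.2.1) (Δ ε ξ s.2.2.1)) *
            sgn (ε t)) / 2) = (1 + ∑ s, (A s).toReal *
      (sgn (s.2.2.2 (Δ ε ξ s.1) (Δ ε ξ s.2.1) (Δ ε ξ s.2.2.1)) * sgn (ε t))) / 2 := by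
        nth_rewrite 2 [← hsum]
        rw [← Finset.sum_add_distrib, Finset.sum_div]
        exact Finset.sum_congr rfl fun s _ => by ring
      rw [h3] at this
      linarith
    · intro s _
      rw [Set.indicator_apply]
      split_ifs
      · exact A.apply_ne_top s
      · simp
  have hlow : T * (2 * θ) ≤ ∑ ε : Fin m → ℤˣ, ∑ ξ : Fin n → ℤˣ, ∑ s, (A s).toReal *
      (sgn (s.2.2.2 (Δ ε ξ s.1) (Δ ε ξ s.2.1) (Δ ε ξ s.2.2.1)) * sgn (ε t)) := by
    calc T * (2 * θ) = ∑ ε : Fin m → ℤˣ, ∑ ξ : Fin n → ℤˣ, 2 * θ := by simp [hT]; ring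
      _ ≤ _ := Finset.sum_le_sum fun ε _ => Finset.sum_le_sum fun ξ _ => hpoint ε ξ
  have hupp : ∑ ε : Fin m → ℤˣ, ∑ ξ : Fin n → ℤˣ, ∑ s, (A s).toReal *
      (sgn (s.2.2.2 (Δ ε ξ s.1) (Δ ε ξ s.2.1) (Δ ε ξ s.2.2.1)) * sgn (ε t)) ≤ T * (8 * θ / 5) := by
    rw [Finset.sum_congr rfl (fun _ _ => Finset.sum_comm), Finset.sum_comm]
    simp_rw [← Finset.mul_sum]
    calc _ ≤ ∑ s, (A s).toReal * (T * (8 * θ / 5)) :=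
          Finset.sum_le_sum fun s _ => mul_le_mul_of_nonneg_left (hquery s) ENNReal.toReal_nonneg
      _ = _ := by rw [← Finset.sum_mul, hsum, one_mul]
  have := le_of_mul_le_mul_left (hlow.trans hupp) hT0
  linarith

/-- Disjoint sets of at most three positions that are correlated with `ε_t`, taken from a maximal such
family: its union is too large to be corrupted. -/
theorem exists_matching {m n : ℕ} {φ θ : ℝ} (hθ : 0 < θ)
    {C : (Fin m → ℤˣ) → (Fin n → ℤˣ)} (hC : IsThreeQueryLDC φ θ C) (t : Fin m) :
    ∃ M : Finset (Finset (Fin n)), (M : Set (Finset (Fin n))).PairwiseDisjoint id ∧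
      (∀ S ∈ M, S.Nonempty ∧ S.card ≤ 3 ∧ θ / 5 ≤ |messageCorr C t S|) ∧ φ * n < 3 * M.card := by
  classical
  set P : Finset (Finset (Fin n)) → Prop := fun M =>
    (M : Set (Finset (Fin n))).PairwiseDisjoint id ∧
      ∀ S ∈ M, S.Nonempty ∧ S.card ≤ 3 ∧ θ / 5 ≤ |messageCorr C t S| with hP
  obtain ⟨M, hM, hmax⟩ := Finset.exists_max_image (Finset.univ.filter P) Finset.card
    ⟨∅, by simp [hP]⟩
  simp only [Finset.mem_filter, Finset.mem_univ, true_and] at hM hmax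
  refine ⟨M, hM.1, hM.2, ?_⟩
  by_contra! hle
  have hcard : (M.biUnion id).card ≤ 3 * M.card := by
    rw [mul_comm]
    exact Finset.card_biUnion_le_card_mul _ _ _ fun S hS => (hM.2 S hS).2.1
  obtain ⟨S, hS3, hSV, hS⟩ := exists_correlated_set hθ hC t (M.biUnion id)
    (le_trans (by exact_mod_cast hcard) hle)
  have hne : S.Nonempty := by
    rw [Finset.nonempty_iff_ne_empty]
    rintro rfl
    have : messageCorr C t ∅ = 0 := by
      have := sum_walsh ({t} : Finset (Fin m))
      rw [if_neg (Finset.singleton_ne_empty t)] at this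
      simp only [messageCorr, walshCoeff]
      simp only [walsh, Finset.prod_empty, mul_one] at this ⊢
      rw [this, zero_div]
    rw [this, abs_zero] at hS
    linarith
  have hdisj : ∀ S' ∈ M, Disjoint S S' := fun S' hS' =>
    Finset.disjoint_of_subset_right (Finset.subset_biUnion_of_mem id hS') hSV
  have hSM : S ∉ M := fun h => hne.ne_empty (Finset.disjoint_self_iff_empty S |>.mp (hdisj S h))
  have := hmax (insert S M) ⟨by
    rw [Finset.coe_insert]
    exact hM.1.insert fun S' hS' _ => hdisj S' hS', by
    intro S' hS'
    rcases Finset.mem_insert.mp hS' with rfl | h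
    · exact ⟨hne, hS3, hS⟩
    · exact hM.2 S' h⟩
  rw [Finset.card_insert_of_notMem hSM] at this
  omega

/-- The word `δ` of length `n`, followed by `2n` symbols `1`. -/
def padded {n : ℕ} (δ : Fin n → ℤˣ) (i : Fin (3 * n)) : ℤˣ :=
  if h : (i : ℕ) < n then δ ⟨i, h⟩ else 1

/-- The position of the `i`-th symbol of the word in its padding. -/
def padCode {n : ℕ} (i : Fin n) : Fin (3 * n) := ⟨i, by omega⟩

/-- A position of the padding that holds the constant `1`, a different one for each `i`. -/
def padConst {n : ℕ} (i : Fin n) : Fin (3 * n) := ⟨n + i, by omega⟩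

theorem padded_padCode {n : ℕ} (δ : Fin n → ℤˣ) (i : Fin n) : padded δ (padCode i) = δ i := by
  simp [padded, padCode]

theorem padded_padConst {n : ℕ} (δ : Fin n → ℤˣ) (i : Fin n) : padded δ (padConst i) = 1 := by
  simp [padded, padConst]

/-- The positions of the padded word that belong to `S`: one symbol and one constant for each
element. They allow sets of fewer than three positions to be completed to triples, disjointly for
disjoint sets. -/
def padSet {n : ℕ} (S : Finset (Fin n)) : Finset (Fin (3 * n)) :=
  S.image padCode ∪ S.image padConst

theorem disjoint_padSet {n : ℕ} {S T : Finset (Fin n)} (h : Disjoint S T) :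
    Disjoint (padSet S) (padSet T) := by
  rw [Finset.disjoint_left] at h ⊢
  intro x hx hx'
  simp only [padSet, Finset.mem_union, Finset.mem_image, padCode, padConst] at hx hx'
  rcases hx with ⟨i, hi, rfl⟩ | ⟨i, hi, rfl⟩ <;> rcases hx' with ⟨j, hj, hij⟩ | ⟨j, hj, hij⟩ <;>
    simp only [Fin.mk.injEq] at hij
  · exact h hi (by rwa [← Fin.ext hij])
  · omega
  · omega
  · exact h hi (by rwa [← Fin.ext (by omega : (j : ℕ) = i)])

theorem exists_triple {n : ℕ} (S : Finset (Fin n)) (hS : S.Nonempty) (hS3 : S.card ≤ 3) :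
    ∃ a ∈ padSet S, ∃ b ∈ padSet S, ∃ c ∈ padSet S, ∀ δ : Fin n → ℤˣ,
      sgn (padded δ a) * sgn (padded δ b) * sgn (padded δ c) = walsh S δ := by
  have hcode : ∀ i ∈ S, padCode i ∈ padSet S := fun i hi =>
    Finset.mem_union_left _ (Finset.mem_image_of_mem _ hi)
  have hconst : ∀ i ∈ S, padConst i ∈ padSet S := fun i hi =>
    Finset.mem_union_right _ (Finset.mem_image_of_mem _ hi)
  have h0 : 0 < S.card := hS.card_pos
  obtain h | h | h : S.card = 1 ∨ S.card = 2 ∨ S.card = 3 := by omega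
  · obtain ⟨x, rfl⟩ := Finset.card_eq_one.mp h
    refine ⟨_, hcode x (by simp), _, hconst x (by simp), _, hconst x (by simp), fun δ => ?_⟩
    simp [padded_padCode, padded_padConst, walsh, sgn]
  · obtain ⟨x, y, hxy, rfl⟩ := Finset.card_eq_two.mp h
    refine ⟨_, hcode x (by simp), _, hcode y (by simp), _, hconst x (by simp), fun δ => ?_⟩
    simp [padded_padCode, padded_padConst, walsh, sgn, hxy]
  · obtain ⟨x, y, z, hxy, hxz, hyz, rfl⟩ := Finset.card_eq_three.mp h
    refine ⟨_, hcode x (by simp), _, hcode y (by simp), _, hcode z (by simp), fun δ => ?_⟩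
    simp [padded_padCode, walsh, sgn, hxy, hxz, hyz, mul_assoc]

theorem exists_perm_extending {α β : Type*} [Fintype α] (M : Finset β) (a b : β → α)
    (ha : Set.InjOn a M) (hb : Set.InjOn b M) : ∃ σ : Equiv.Perm α, ∀ S ∈ M, σ (a S) = b S := by
  classical
  rcases M.eq_empty_or_nonempty with rfl | ⟨S₀, hS₀⟩
  · exact ⟨1, by simp⟩
  have : Nonempty β := ⟨S₀⟩
  have hinv : ∀ S ∈ M, Function.invFunOn a M (a S) = S := fun S hS => ha.leftInvOn_invFunOn hS
  have hinj : Set.InjOn (fun x => b (Function.invFunOn a M x)) (M.image a : Finset α) := by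
    intro x hx y hy hxy
    simp only [Finset.coe_image, Set.mem_image, Finset.mem_coe] at hx hy
    obtain ⟨S, hS, rfl⟩ := hx
    obtain ⟨S', hS', rfl⟩ := hy
    simp only [hinv S hS, hinv S' hS'] at hxy
    rw [hb hS hS' hxy]
  obtain ⟨g, hg⟩ := Finset.exists_equiv_extend_of_card_eq (t := Finset.univ) (by simp)
    (Finset.subset_univ _) hinj
  refine ⟨g.trans (Equiv.subtypeUnivEquiv fun x => Finset.mem_univ x), fun S hS => ?_⟩
  have := hg (a S) (Finset.mem_image_of_mem a hS)
  simp only [hinv S hS] at this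
  simpa using this

/-- The matching as the part over `U` of the graph `x ↦ (x, σ x, τ x)` of a pair of permutations: the triples
of a matching are distinct in each of the three coordinates. -/
theorem exists_permutations {m n : ℕ} {φ θ : ℝ} (hθ : 0 < θ)
    {C : (Fin m → ℤˣ) → (Fin n → ℤˣ)} (hC : IsThreeQueryLDC φ θ C) (t : Fin m) :
    ∃ (U : Finset (Fin (3 * n))) (σ τ : Equiv.Perm (Fin (3 * n))), φ * n < 3 * U.card ∧
      ∀ x ∈ U, θ / 5 ≤ |walshCoeff (fun ε => sgn (padded (C ε) x) * sgn (padded (C ε) (σ x)) *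
        sgn (padded (C ε) (τ x))) {t}| := by
  classical
  obtain ⟨M, hdisj, hM, hcard⟩ := exists_matching hθ hC t
  have : ∀ S : Finset (Fin n), ∃ x : Fin (3 * n) × Fin (3 * n) × Fin (3 * n), S ∈ M →
      x.1 ∈ padSet S ∧ x.2.1 ∈ padSet S ∧ x.2.2 ∈ padSet S ∧ ∀ δ : Fin n → ℤˣ,
        sgn (padded δ x.1) * sgn (padded δ x.2.1) * sgn (padded δ x.2.2) = walsh S δ := by
    intro S
    by_cases hS : S ∈ M
    · obtain ⟨a, ha, b, hb, c, hc, h⟩ := exists_triple S (hM S hS).1 (hM S hS).2.1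
      exact ⟨(a, b, c), fun _ => ⟨ha, hb, hc, h⟩⟩
    · have : 0 < n := by
        by_contra hn
        have hn0 : n = 0 := by omega
        subst hn0
        simp at hcard
        obtain ⟨S', hS'⟩ := hcard
        obtain ⟨i, _⟩ := (hM S' hS').1
        exact i.elim0
      exact ⟨(⟨0, by omega⟩, ⟨0, by omega⟩, ⟨0, by omega⟩), fun h => absurd h hS⟩
  choose x hx using this
  have hinj : ∀ f : Finset (Fin n) → Fin (3 * n), (∀ S ∈ M, f S ∈ padSet S) → Set.InjOn f M := by
    intro f hf S hS S' hS' h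
    by_contra hne
    have := disjoint_padSet (hdisj hS hS' hne)
    exact Finset.disjoint_left.mp this (hf S hS) (h ▸ hf S' hS')
  have ha := hinj (fun S => (x S).1) fun S hS => (hx S hS).1
  have hb := hinj (fun S => (x S).2.1) fun S hS => (hx S hS).2.1
  have hc := hinj (fun S => (x S).2.2) fun S hS => (hx S hS).2.2.1
  obtain ⟨σ, hσ⟩ := exists_perm_extending M _ _ ha hb
  obtain ⟨τ, hτ⟩ := exists_perm_extending M _ _ ha hc
  refine ⟨M.image fun S => (x S).1, σ, τ, ?_, ?_⟩
  · rw [Finset.card_image_of_injOn ha]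
    exact hcard
  · intro y hy
    obtain ⟨S, hS, rfl⟩ := Finset.mem_image.mp hy
    have h1 := hσ S hS
    have h2 := hτ S hS
    rw [h1, h2]
    simp_rw [(hx S hS).2.2.2]
    exact (hM S hS).2.2

/-! ### Averaging over the symmetries of the triple tensor product -/

theorem sum_sgn_mul_sgn {N : ℕ} (i k : Fin N) :
    ∑ ε : Fin N → ℤˣ, sgn (ε i) * sgn (ε k) = if i = k then 2 ^ N else 0 := by
  have := sum_walsh_mul_walsh ({i} : Finset (Fin N)) {k}
  simpa [walsh] using this

/-- The tensor with coordinates `a i j k` in the standard basis. -/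
noncomputable def tensorOf {N : ℕ} (a : Fin N → Fin N → Fin N → ℝ) : TripleTensor N :=
  ∑ i, ∑ j, ∑ k, a i j k • stdTensor i j k

theorem tensorOf_sum {N : ℕ} {Ω : Type*} (s : Finset Ω) (a : Ω → Fin N → Fin N → Fin N → ℝ) :
    ∑ ω ∈ s, tensorOf (a ω) = tensorOf (fun i j k => ∑ ω ∈ s, a ω i j k) := by
  simp only [tensorOf, Finset.sum_smul]
  rw [Finset.sum_comm]
  refine Finset.sum_congr rfl fun i _ => ?_
  rw [Finset.sum_comm]
  refine Finset.sum_congr rfl fun j _ => ?_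
  rw [Finset.sum_comm]

theorem smul_tensorOf {N : ℕ} (r : ℝ) (a : Fin N → Fin N → Fin N → ℝ) :
    r • tensorOf a = tensorOf (fun i j k => r * a i j k) := by
  simp only [tensorOf, Finset.smul_sum, smul_smul]

theorem tensorOf_signs_le {N : ℕ} {K : ℝ} {p : Seminorm ℝ (TripleTensor N)}
    (hp : IsTensorSymmetric K p) (ε δ η : Fin N → ℤˣ) :
    p (tensorOf fun i j k => sgn (ε i) * sgn (δ j) * sgn (η k)) ≤
      K * p (∑ i, ∑ j, ∑ k, stdTensor i j k) := by
  have := hp 1 1 1 ε δ η (fun _ _ _ => 1)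
  simpa only [mul_one, one_smul, tensorOf] using this

/-- The tensor `e_i ⊗ e_j ⊗ e_k` is an average of sign changes of `∑ e_i ⊗ e_j ⊗ e_k`. -/
theorem stdTensor_le {N : ℕ} {K : ℝ} {p : Seminorm ℝ (TripleTensor N)}
    (hp : IsTensorSymmetric K p) (i j k : Fin N) :
    p (stdTensor i j k) ≤ K * p (∑ i, ∑ j, ∑ k, stdTensor i j k) := by
  set O := p (∑ i, ∑ j, ∑ k, stdTensor i j k : TripleTensor N)
  have h1 : ∑ ω : (Fin N → ℤˣ) × (Fin N → ℤˣ) × (Fin N → ℤˣ),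
      (sgn (ω.1 i) * sgn (ω.2.1 j) * sgn (ω.2.2 k)) •
        tensorOf (fun i j k => sgn (ω.1 i) * sgn (ω.2.1 j) * sgn (ω.2.2 k)) =
      ((2 : ℝ) ^ N * 2 ^ N * 2 ^ N) • stdTensor i j k := by
    simp_rw [smul_tensorOf]
    rw [tensorOf_sum]
    have h2 : ∀ i' j' k', ∑ ω : (Fin N → ℤˣ) × (Fin N → ℤˣ) × (Fin N → ℤˣ),
        (sgn (ω.1 i) * sgn (ω.2.1 j) * sgn (ω.2.2 k)) *
          (sgn (ω.1 i') * sgn (ω.2.1 j') * sgn (ω.2.2 k')) =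
        if i = i' then (if j = j' then (if k = k' then (2 : ℝ) ^ N * 2 ^ N * 2 ^ N else 0) else 0)
          else 0 := by
      intro i' j' k'
      calc _ = (∑ ε : Fin N → ℤˣ, sgn (ε i) * sgn (ε i')) *
            ((∑ ε : Fin N → ℤˣ, sgn (ε j) * sgn (ε j')) *
              ∑ ε : Fin N → ℤˣ, sgn (ε k) * sgn (ε k')) := by
            rw [Fintype.sum_prod_type, Finset.sum_mul]
            refine Finset.sum_congr rfl fun ε _ => ?_
            rw [Fintype.sum_prod_type, Finset.sum_mul, Finset.mul_sum]
            refine Finset.sum_congr rfl fun δ _ => ?_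
            rw [Finset.mul_sum, Finset.mul_sum]
            exact Finset.sum_congr rfl fun η _ => by ring
        _ = _ := by
            rw [sum_sgn_mul_sgn, sum_sgn_mul_sgn, sum_sgn_mul_sgn]
            split_ifs <;> simp [mul_assoc]
    simp_rw [h2]
    simp [tensorOf, ite_smul]
  have h3 : (2 : ℝ) ^ N * 2 ^ N * 2 ^ N * p (stdTensor i j k) ≤
      (2 : ℝ) ^ N * 2 ^ N * 2 ^ N * (K * O) := by
    calc _ = p (((2 : ℝ) ^ N * 2 ^ N * 2 ^ N) • stdTensor i j k) := by
          rw [map_smul_eq_mul, Real.norm_of_nonneg (by positivity)]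
      _ ≤ ∑ _ω : (Fin N → ℤˣ) × (Fin N → ℤˣ) × (Fin N → ℤˣ), K * O := by
          rw [← h1]
          refine (seminorm_sum_le p _ _).trans (Finset.sum_le_sum fun ω _ => ?_)
          rw [map_smul_eq_mul, Real.norm_eq_abs, abs_mul, abs_mul, abs_sgn, abs_sgn, abs_sgn,
            one_mul, one_mul, one_mul]
          exact tensorOf_signs_le hp _ _ _
      _ = _ := by
          rw [Finset.sum_const, Finset.card_univ, nsmul_eq_mul]
          simp only [Fintype.card_prod, card_cube]
          push_cast
          ring
  exact le_of_mul_le_mul_left h3 (by positivity)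

/-- The coordinates of a tensor on the graph of `x ↦ (x, σ x, τ x)` bound its norm from below: averaging
its symmetric images gives a multiple of the diagonal tensor. All the averages are taken at once, so
that the symmetry constant `K` enters only once. -/
theorem diagonal_le {N : ℕ} {K : ℝ} {p : Seminorm ℝ (TripleTensor N)}
    (hp : IsTensorSymmetric K p) (a : Fin N → Fin N → Fin N → ℝ) (U : Finset (Fin N))
    (σ τ : Equiv.Perm (Fin N)) :
    (∑ x ∈ U, |a x (σ x) (τ x)|) * p (∑ i, stdTensor i i i) ≤ N * (K * p (tensorOf a)) := by
  rcases Nat.eq_zero_or_pos N with rfl | hN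
  · simp
  have : NeZero N := ⟨hN.ne'⟩
  have hs : ∀ x, ∃ u : ℤˣ, sgn u * a x (σ x) (τ x) = |a x (σ x) (τ x)| := by
    intro x
    rcases le_total 0 (a x (σ x) (τ x)) with h | h
    · exact ⟨1, by simp [sgn, abs_of_nonneg h]⟩
    · exact ⟨-1, by simp [sgn, abs_of_nonpos h]⟩
  choose s hs using hs
  set W := ∑ x ∈ U, |a x (σ x) (τ x)| with hW
  set s' : ℤˣ → Fin N → ℤˣ := fun b x => if x ∈ U then s x else b with hs'
  -- The signs `ε_i δ_j ε_k δ_k` average to the indicator of `i = j = k`, the free sign `b` deletes the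
  -- diagonal entries outside `U`, and the cyclic shift by `ω.1.1` makes the diagonal constant.
  set coef : (Fin N × ℤˣ) × (Fin N → ℤˣ) × (Fin N → ℤˣ) → Fin N → Fin N → Fin N → ℝ :=
    fun ω i j k => sgn (ω.2.1 i) * sgn (ω.2.2 j) *
      sgn (ω.2.1 k * ω.2.2 k * s' ω.1.2 (k + ω.1.1)) *
      a (i + ω.1.1) (σ (j + ω.1.1)) (τ (k + ω.1.1)) with hcoef
  have hle : ∀ ω, p (tensorOf (coef ω)) ≤ K * p (tensorOf a) := fun ω =>
    hp (Equiv.addRight ω.1.1) ((Equiv.addRight ω.1.1).trans σ) ((Equiv.addRight ω.1.1).trans τ)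
      ω.2.1 ω.2.2 (fun k => ω.2.1 k * ω.2.2 k * s' ω.1.2 (k + ω.1.1)) a
  have hdiag : ∀ k : Fin N, ∑ cb : Fin N × ℤˣ, sgn (s' cb.2 (k + cb.1)) *
      a (k + cb.1) (σ (k + cb.1)) (τ (k + cb.1)) = 2 * W := by
    intro k
    have h1 : ∀ x, ∑ b : ℤˣ, sgn (s' b x) * a x (σ x) (τ x) =
        if x ∈ U then 2 * |a x (σ x) (τ x)| else 0 := by
      intro x
      rw [← Finset.sum_mul]
      by_cases hx : x ∈ U
      · simp only [hs', hx, if_true]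
        rw [← hs x, Finset.sum_const, Finset.card_univ, Fintype.card_units_int]
        simp [mul_assoc]
      · simp only [hs', hx, if_false]
        rw [sum_sgn, zero_mul]
    rw [Fintype.sum_prod_type]
    simp_rw [h1]
    calc _ = ∑ x, if x ∈ U then 2 * |a x (σ x) (τ x)| else 0 :=
          Equiv.sum_comp (Equiv.addLeft k) (fun x => if x ∈ U then 2 * |a x (σ x) (τ x)| else 0)
      _ = 2 * W := by rw [Finset.sum_ite_mem, Finset.univ_inter, ← Finset.mul_sum]
  have hsum : ∀ i j k, ∑ ω, coef ω i j k =
      if i = k then (if j = k then 2 ^ N * 2 ^ N * (2 * W) else 0) else 0 := by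
    intro i j k
    calc _ = (∑ cb : Fin N × ℤˣ, sgn (s' cb.2 (k + cb.1)) *
            a (i + cb.1) (σ (j + cb.1)) (τ (k + cb.1))) *
          ((∑ ε : Fin N → ℤˣ, sgn (ε i) * sgn (ε k)) *
            ∑ ε : Fin N → ℤˣ, sgn (ε j) * sgn (ε k)) := by
          rw [Fintype.sum_prod_type, Finset.sum_mul]
          refine Finset.sum_congr rfl fun cb _ => ?_
          rw [Fintype.sum_prod_type, Finset.sum_mul, Finset.mul_sum]
          refine Finset.sum_congr rfl fun ε _ => ?_
          rw [Finset.mul_sum, Finset.mul_sum]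
          refine Finset.sum_congr rfl fun δ _ => ?_
          simp only [hcoef, sgn, Units.val_mul, Int.cast_mul]
          ring
      _ = _ := by
          rw [sum_sgn_mul_sgn, sum_sgn_mul_sgn]
          by_cases h1 : i = k
          · by_cases h2 : j = k
            · subst h1 h2
              rw [hdiag]
              simp only [if_true]
              ring
            · simp [h1, h2]
          · simp [h1]
  have htot : ∑ ω, tensorOf (coef ω) =
      ((2 : ℝ) ^ N * 2 ^ N * (2 * W)) • ∑ i : Fin N, stdTensor i i i := by
    rw [tensorOf_sum]
    simp_rw [hsum]
    simp only [tensorOf, ite_smul, zero_smul, Finset.smul_sum]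
    refine Finset.sum_congr rfl fun i _ => ?_
    rw [Finset.sum_comm]
    simp
  have hW0 : 0 ≤ W := Finset.sum_nonneg fun _ _ => abs_nonneg _
  have h3 : (2 : ℝ) ^ N * 2 ^ N * 2 * (W * p (∑ i : Fin N, stdTensor i i i)) ≤
      (2 : ℝ) ^ N * 2 ^ N * 2 * (N * (K * p (tensorOf a))) := by
    calc _ = p (((2 : ℝ) ^ N * 2 ^ N * (2 * W)) • ∑ i : Fin N, stdTensor i i i) := by
          rw [map_smul_eq_mul, Real.norm_of_nonneg (by positivity)]
          ring
      _ ≤ ∑ _ω : (Fin N × ℤˣ) × (Fin N → ℤˣ) × (Fin N → ℤˣ), K * p (tensorOf a) := by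
          rw [← htot]
          exact (seminorm_sum_le p _ _).trans (Finset.sum_le_sum fun ω _ => hle ω)
      _ = _ := by simp; ring
  exact le_of_mul_le_mul_left h3 (by positivity)

theorem sum_stdTensor_diag_ne_zero {N : ℕ} (hN : 0 < N) :
    (∑ i : Fin N, stdTensor i i i : TripleTensor N) ≠ 0 := by
  intro h
  -- pointwise multiplication `x ⊗ y ⊗ z ↦ x y z`
  set μ : TripleTensor N →ₗ[ℝ] (Fin N → ℝ) :=
    (LinearMap.mul' ℝ (Fin N → ℝ)).comp
      (TensorProduct.map (LinearMap.mul' ℝ (Fin N → ℝ)) LinearMap.id) with hμ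
  have h1 : ∀ i : Fin N, μ (stdTensor i i i) = Pi.single i 1 := by
    intro i
    have : μ (stdTensor i i i) =
        (Pi.single i 1 * Pi.single i 1 : Fin N → ℝ) * Pi.single i 1 := rfl
    rw [this, ← Pi.single_mul, ← Pi.single_mul]
    simp
  have h2 := congrArg μ h
  rw [map_sum, map_zero] at h2
  simp_rw [h1] at h2
  have h3 := congrFun h2 ⟨0, hN⟩
  simp [Finset.sum_apply, Pi.single_apply] at h3

/-! ### Cotype constants of finite-dimensional norms -/

theorem exists_coord_bound {E : Type*} [AddCommGroup E] [Module ℝ E] [Module.Finite ℝ E]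
    (p : Seminorm ℝ E) (hp : ∀ x, p x = 0 → x = 0) (ℓ : E →ₗ[ℝ] ℝ) :
    ∃ Λ : ℝ, ∀ x, |ℓ x| ≤ Λ * p x := by
  let _ : NormedAddCommGroup E := AddGroupNorm.toNormedAddCommGroup
    { p.toAddGroupSeminorm with eq_zero_of_map_eq_zero' := hp }
  let _ : NormedSpace ℝ E :=
    { (inferInstance : Module ℝ E) with norm_smul_le := fun r x => (map_smul_eq_mul p r x).le }
  exact ⟨‖LinearMap.toContinuousLinearMap ℓ‖, fun x =>
    (LinearMap.toContinuousLinearMap ℓ).le_opNorm x⟩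

theorem sum_sq_signed_sum {k : ℕ} (c : Fin k → ℝ) :
    ∑ ε : Fin k → ℤˣ, (∑ i, sgn (ε i) * c i) ^ 2 = 2 ^ k * ∑ i, c i ^ 2 := by
  simp_rw [sq, Finset.sum_mul_sum]
  rw [Finset.sum_comm, Finset.mul_sum]
  refine Finset.sum_congr rfl fun i _ => ?_
  rw [Finset.sum_comm]
  have : ∀ j, ∑ ε : Fin k → ℤˣ, sgn (ε i) * c i * (sgn (ε j) * c j) =
      if i = j then 2 ^ k * (c i * c j) else 0 := by
    intro j
    calc _ = (∑ ε : Fin k → ℤˣ, sgn (ε i) * sgn (ε j)) * (c i * c j) := by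
          rw [Finset.sum_mul]; exact Finset.sum_congr rfl fun ε _ => by ring
      _ = _ := by rw [sum_sgn_mul_sgn]; split_ifs <;> ring
  simp_rw [this]
  simp

theorem rpow_sum_rpow_le_sqrt_sum_sq {k : ℕ} (a : Fin k → ℝ) (ha : ∀ i, 0 ≤ a i) {q : ℝ}
    (hq : 2 ≤ q) : (∑ i, a i ^ q) ^ (1 / q) ≤ √(∑ i, a i ^ 2) := by
  set S := √(∑ i, a i ^ 2) with hS
  have hS0 : 0 ≤ S := Real.sqrt_nonneg _
  have hS2 : S ^ 2 = ∑ i, a i ^ 2 := Real.sq_sqrt (Finset.sum_nonneg fun i _ => sq_nonneg _)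
  have hle : ∀ i, a i ≤ S := fun i => Real.le_sqrt_of_sq_le
    (Finset.single_le_sum (f := fun i => a i ^ 2) (fun i _ => sq_nonneg _) (Finset.mem_univ i))
  have hsplit : ∀ x : ℝ, 0 ≤ x → x ^ q = x ^ 2 * x ^ (q - 2) := by
    intro x hx
    have := Real.rpow_add_of_nonneg hx (by norm_num : (0 : ℝ) ≤ 2) (by linarith : 0 ≤ q - 2)
    rw [← Real.rpow_two, ← this]
    congr 1; ring
  have h1 : ∑ i, a i ^ q ≤ S ^ q := by
    rw [hsplit S hS0, hS2, Finset.sum_mul]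
    refine Finset.sum_le_sum fun i _ => ?_
    rw [hsplit _ (ha i)]
    exact mul_le_mul_of_nonneg_left (Real.rpow_le_rpow (ha i) (hle i) (by linarith)) (sq_nonneg _)
  calc _ ≤ (S ^ q) ^ (1 / q) := Real.rpow_le_rpow
        (Finset.sum_nonneg fun i _ => Real.rpow_nonneg (ha i) _) h1 (by positivity)
    _ = S := by rw [← Real.rpow_mul hS0, mul_one_div_cancel (by positivity), Real.rpow_one]

/-- A finite-dimensional norm has finite cotype `q` constant for `q ≥ 2`, by comparison with a
Euclidean norm. -/
theorem exists_cotypeIneq {E : Type*} [AddCommGroup E] [Module ℝ E] [Module.Finite ℝ E]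
    (p : Seminorm ℝ E) (hp : ∀ x, p x = 0 → x = 0) {q : ℝ} (hq : 2 ≤ q) :
    ∃ C, 0 < C ∧ CotypeIneq p q C := by
  set b := Module.finBasis ℝ E
  choose Λ hΛ using fun j => exists_coord_bound p hp (b.coord j)
  set P := ∑ j, p (b j) ^ 2 with hP
  have hP0 : 0 ≤ P := Finset.sum_nonneg fun _ _ => sq_nonneg _
  set Q := ∑ j, Λ j ^ 2 with hQ
  have hQ0 : 0 ≤ Q := Finset.sum_nonneg fun _ _ => sq_nonneg _
  have hupper : ∀ x, p x ^ 2 ≤ P * ∑ j, b.coord j x ^ 2 := by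
    intro x
    have h1 : p x ≤ ∑ j, p (b j) * |b.coord j x| := by
      conv_lhs => rw [← b.sum_repr x]
      refine (seminorm_sum_le p _ _).trans (Finset.sum_le_sum fun j _ => ?_)
      rw [map_smul_eq_mul, Real.norm_eq_abs, mul_comm]
      rfl
    calc p x ^ 2 ≤ (∑ j, p (b j) * |b.coord j x|) ^ 2 := by gcongr
      _ ≤ P * ∑ j, |b.coord j x| ^ 2 := Finset.sum_mul_sq_le_sq_mul_sq _ _ _
      _ = _ := by simp_rw [sq_abs]
  have hlower : ∀ x, ∑ j, b.coord j x ^ 2 ≤ Q * p x ^ 2 := by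
    intro x
    rw [hQ, Finset.sum_mul]
    refine Finset.sum_le_sum fun j _ => ?_
    rw [← sq_abs, ← mul_pow]
    exact pow_le_pow_left₀ (abs_nonneg _) (hΛ j x) 2
  refine ⟨√(P * Q) + 1, by positivity, fun k x => ?_⟩
  set R := (∑ ε : Fin k → ℤˣ, p (∑ i, ((ε i : ℤ) : ℝ) • x i) ^ 2) / 2 ^ k with hR
  have hR0 : 0 ≤ R := by positivity
  have hmain : ∑ i, p (x i) ^ 2 ≤ P * Q * R := by
    calc ∑ i, p (x i) ^ 2 ≤ ∑ i, P * ∑ j, b.coord j (x i) ^ 2 :=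
          Finset.sum_le_sum fun i _ => hupper _
      _ = P * ∑ j, ∑ i, b.coord j (x i) ^ 2 := by rw [← Finset.mul_sum, Finset.sum_comm]
      _ = P * ((∑ ε : Fin k → ℤˣ, ∑ j, b.coord j (∑ i, sgn (ε i) • x i) ^ 2) / 2 ^ k) := by
          congr 1
          conv_rhs => rw [Finset.sum_comm, Finset.sum_div]
          refine Finset.sum_congr rfl fun j _ => ?_
          have := sum_sq_signed_sum (fun i => b.coord j (x i))
          have h2 : ∀ ε : Fin k → ℤˣ, b.coord j (∑ i, sgn (ε i) • x i) =
              ∑ i, sgn (ε i) * b.coord j (x i) := fun ε => by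
            rw [map_sum]
            exact Finset.sum_congr rfl fun i _ => map_smul _ _ _
          simp_rw [h2]
          rw [this]
          field_simp
      _ ≤ P * ((∑ ε : Fin k → ℤˣ, Q * p (∑ i, sgn (ε i) • x i) ^ 2) / 2 ^ k) := by
          gcongr with ε
          exact hlower _
      _ = _ := by rw [← Finset.mul_sum, hR]; ring
  calc _ ≤ √(∑ i, p (x i) ^ 2) := rpow_sum_rpow_le_sqrt_sum_sq _ (fun i => apply_nonneg p _) hq
    _ ≤ √(P * Q * R) := Real.sqrt_le_sqrt hmain
    _ = √(P * Q) * √R := Real.sqrt_mul (by positivity) _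
    _ ≤ _ := by gcongr; linarith

/-- The inequality passes to the infimum `cotypeConst`. Finite dimension matters: the infimum of the
empty set of reals is `0`. -/
theorem cotypeIneq_cotypeConst {E : Type*} [AddCommGroup E] [Module ℝ E] [Module.Finite ℝ E]
    (p : Seminorm ℝ E) (hp : ∀ x, p x = 0 → x = 0) {q : ℝ} (hq : 2 ≤ q) :
    CotypeIneq p q (cotypeConst p q) := by
  intro k x
  set R := √((∑ ε : Fin k → ℤˣ, p (∑ i, ((ε i : ℤ) : ℝ) • x i) ^ 2) / 2 ^ k) with hR
  obtain ⟨C₀, hC₀, hC₀'⟩ := exists_cotypeIneq p hp hq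
  have hR0 : 0 ≤ R := Real.sqrt_nonneg _
  rcases hR0.eq_or_lt with h | h
  · have := hC₀' k x
    rw [← hR, ← h, mul_zero] at this
    rwa [← h, mul_zero]
  · rw [← div_le_iff₀ h]
    exact le_csInf ⟨C₀, hC₀, hC₀'⟩ fun C hC => (div_le_iff₀ h).mpr (hC.2 k x)

/-! ### The lower bound for the cotype constant -/

theorem clog_le_three_mul_log (n : ℕ) (hn : 0 < n) :
    (Nat.clog 2 (n + 1) : ℝ) ≤ 3 * Real.log ((n : ℝ) + 1) := by
  set l := Nat.clog 2 (n + 1) with hl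
  have h1 : 2 ^ (l - 1) < n + 1 := Nat.pow_pred_clog_lt_self (by norm_num) (by omega)
  have hl1 : 1 ≤ l := Nat.clog_pos (by norm_num) (by omega)
  have h2 : ((l : ℝ) - 1) * Real.log 2 ≤ Real.log ((n : ℝ) + 1) := by
    have h3 : (2 : ℝ) ^ (l - 1) ≤ (n : ℝ) + 1 := by exact_mod_cast h1.le
    have := Real.log_le_log (by positivity) h3
    rwa [Real.log_pow, Nat.cast_sub hl1, Nat.cast_one] at this
  have h3 : Real.log 2 ≤ Real.log ((n : ℝ) + 1) := by
    refine Real.log_le_log (by norm_num) ?_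
    have : (1 : ℝ) ≤ n := by exact_mod_cast hn
    linarith
  have h4 := Real.log_two_gt_d9
  have h5 : (0 : ℝ) ≤ l := by positivity
  nlinarith

instance (N : ℕ) : Module.Finite ℝ (TripleTensor N) :=
  inferInstanceAs (Module.Finite ℝ ((Fin N → ℝ) ⊗[ℝ] (Fin N → ℝ) ⊗[ℝ] (Fin N → ℝ)))

theorem theorem2 :
    ∃ c : ℝ, 0 < c ∧
      ∀ (m n : ℕ), 0 < m → 0 < n →
      ∀ (φ θ : ℝ), φ ∈ Set.Ioo (0 : ℝ) (1 / 2) → θ ∈ Set.Ioo (0 : ℝ) (1 / 2) →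
      (∃ C : (Fin m → ℤˣ) → (Fin n → ℤˣ), IsThreeQueryLDC φ θ C) →
      ∀ (K : ℝ), 1 ≤ K →
      -- a norm on the triple tensor product: a seminorm that vanishes only at zero
      ∀ (p : Seminorm ℝ (TripleTensor (3 * n))), (∀ x, p x = 0 → x = 0) →
      IsTensorSymmetric K p →
      ∀ (q : ℝ), 2 ≤ q →
        c * (φ * θ ^ 2 * (m : ℝ) ^ (1 / q) / Real.log ((n : ℝ) + 1)) ≤
          K ^ 2 * cotypeConst p q *
            (p (∑ i : Fin (3 * n), ∑ j : Fin (3 * n), ∑ k : Fin (3 * n), stdTensor i j k) /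
              p (∑ i : Fin (3 * n), stdTensor i i i)) := by
  refine ⟨1 / 9720, by norm_num, ?_⟩
  rintro m n - hn φ θ ⟨hφ, -⟩ ⟨hθ, hθ'⟩ ⟨C, hC⟩ K hK p hp hsym q hq
  -- Here `1 / 9720 = (1 / 45) * (1 / (8 * 27))`: each `y_t` has norm at least `φ θ D / (45 K)`, and the
  -- projection bound is `8 L K O` with `L = 9 l ≤ 27 log (n + 1)`.
  set D := p (∑ i : Fin (3 * n), stdTensor i i i) with hD
  set O := p (∑ i : Fin (3 * n), ∑ j : Fin (3 * n), ∑ k : Fin (3 * n), stdTensor i j k) with hO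
  set l := Nat.clog 2 (n + 1) with hl
  have hD0 : 0 < D := (apply_nonneg p _).lt_of_ne fun h =>
    sum_stdTensor_diag_ne_zero (by omega) (hp _ h.symm)
  have hO0 : 0 ≤ O := apply_nonneg p _
  have hK0 : 0 < K := by linarith
  have hn0 : (0 : ℝ) < n := by exact_mod_cast hn
  have hlog : 0 < Real.log ((n : ℝ) + 1) := Real.log_pos (by linarith)
  have hl1 : 1 ≤ l := Nat.clog_pos (by norm_num) (by omega)
  have hl2 : n + 1 ≤ 2 ^ l := Nat.le_pow_clog (by norm_num) _
  -- `F ε = ∑ x, f x ε • e x` is the triple tensor power of the padded codeword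
  set f : Fin (3 * n) × Fin (3 * n) × Fin (3 * n) → (Fin m → ℤˣ) → ℝ := fun x ε =>
    sgn (padded (C ε) x.1) * sgn (padded (C ε) x.2.1) * sgn (padded (C ε) x.2.2) with hf
  set e : Fin (3 * n) × Fin (3 * n) × Fin (3 * n) → TripleTensor (3 * n) := fun x =>
    stdTensor x.1 x.2.1 x.2.2 with he
  set a : Fin m → Fin (3 * n) → Fin (3 * n) → Fin (3 * n) → ℝ := fun t i j k =>
    walshCoeff (f (i, j, k)) {t} with ha
  have hsum : ∀ g : Fin (3 * n) × Fin (3 * n) × Fin (3 * n) → ℝ,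
      ∑ x, g x • e x = tensorOf fun i j k => g (i, j, k) := by
    intro g
    simp_rw [Fintype.sum_prod_type]
    rfl
  have hcard : Fintype.card (Fin (3 * n) × Fin (3 * n) × Fin (3 * n)) ≤ 2 ^ (9 * l) := by
    have h2 : 2 ≤ 2 ^ l := by
      calc 2 = 2 ^ 1 := rfl
        _ ≤ 2 ^ l := Nat.pow_le_pow_right (by norm_num) hl1
    have h3 : 3 * n ≤ (2 ^ l) ^ 3 := by
      calc 3 * n ≤ 2 ^ l * (2 * 2) := by omega
        _ ≤ 2 ^ l * (2 ^ l * 2 ^ l) := by gcongr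
        _ = _ := by ring
    calc _ = (3 * n) * ((3 * n) * (3 * n)) := by simp
      _ ≤ (2 ^ l) ^ 3 * ((2 ^ l) ^ 3 * (2 ^ l) ^ 3) := by gcongr
      _ = _ := by rw [← pow_mul, ← pow_add, ← pow_add]; congr 1; ring
  have hproj := rademacher_projection_bound p e f (K * O) (by positivity) (9 * l) (by omega)
    (fun x ε => by simp only [hf, abs_mul, abs_sgn, mul_one, le_refl])
    (fun ε => by rw [hsum]; exact tensorOf_signs_le hsym _ _ _)
    (fun x => stdTensor_le hsym _ _ _) hcard
  simp_rw [hsum] at hproj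
  -- the Walsh coefficients of `F` at the singletons are large, by averaging over the symmetries
  have hlower : ∀ t, φ * θ * D / (45 * K) ≤ p (tensorOf (a t)) := by
    intro t
    obtain ⟨U, σ, τ, hU, hcorr⟩ := exists_permutations hθ hC t
    have h1 := diagonal_le hsym (a t) U σ τ
    have h2 : U.card * (θ / 5) ≤ ∑ x ∈ U, |a t x (σ x) (τ x)| := by
      rw [← nsmul_eq_mul]
      exact Finset.card_nsmul_le_sum _ _ _ hcorr
    rw [div_le_iff₀ (by positivity)]
    have h3 : φ * n / 3 * (θ / 5) * D ≤ (3 * n : ℕ) * (K * p (tensorOf (a t))) := by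
      refine le_trans ?_ h1
      refine mul_le_mul_of_nonneg_right (le_trans ?_ h2) hD0.le
      gcongr
      linarith
    push_cast at h3
    have h4 : n * (φ * θ * D) ≤ n * (p (tensorOf (a t)) * (45 * K)) := by linarith
    exact le_of_mul_le_mul_left h4 hn0
  have hcot := cotypeIneq_cotypeConst p hp hq m (fun t => tensorOf (a t))
  set Q := cotypeConst p q with hQ
  have hQ0 : 0 ≤ Q := Real.sInf_nonneg fun c hc => hc.1.le
  have hq0 : 0 < q := by linarith
  have hleft : φ * θ * D / (45 * K) * (m : ℝ) ^ (1 / q) ≤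
      (∑ t, p (tensorOf (a t)) ^ q) ^ (1 / q) := by
    have hb : 0 ≤ φ * θ * D / (45 * K) := by positivity
    calc _ = (∑ _t : Fin m, (φ * θ * D / (45 * K)) ^ q) ^ (1 / q) := by
          rw [Finset.sum_const, Finset.card_univ, Fintype.card_fin, nsmul_eq_mul,
            Real.mul_rpow (by positivity) (by positivity), ← Real.rpow_mul hb,
            mul_one_div_cancel hq0.ne', Real.rpow_one, mul_comm]
      _ ≤ _ := by
          gcongr with t
          exact hlower t
  have hright : √((∑ ε : Fin m → ℤˣ, p (∑ t, ((ε t : ℤ) : ℝ) • tensorOf (a t)) ^ 2) / 2 ^ m) ≤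
      8 * (9 * l : ℕ) * (K * O) := Real.sqrt_le_iff.mpr ⟨by positivity, hproj⟩
  have hclog := clog_le_three_mul_log n hn
  rw [← hl] at hclog
  set B := (m : ℝ) ^ (1 / q) with hB
  have hB0 : 0 ≤ B := by positivity
  have hfin : φ * θ * D / (45 * K) * B ≤ Q * (216 * Real.log ((n : ℝ) + 1) * (K * O)) := by
    refine hleft.trans (hcot.trans ?_)
    refine mul_le_mul_of_nonneg_left (hright.trans ?_) hQ0
    push_cast
    refine mul_le_mul_of_nonneg_right ?_ (by positivity)
    linarith
  rw [div_mul_eq_mul_div, div_le_iff₀ (by positivity)] at hfin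
  rw [← mul_div_assoc, ← mul_div_assoc, div_le_div_iff₀ hlog hD0]
  have hθ2 : φ * θ ^ 2 * B * D ≤ φ * θ * D * B := by
    have : θ ^ 2 ≤ θ := by nlinarith
    calc _ = φ * D * B * θ ^ 2 := by ring
      _ ≤ φ * D * B * θ := by gcongr
      _ = _ := by ring
  nlinarith
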